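/- Let $n_1,n_2>1$ be integers, $n=n_1+n_2$, let $a_1,\dots,a_n\in(-1,1)$, $\vec a_1=(a_1,\dots,a_{n_1})'$, $\vec a_2=(a_{n_1+1},\dots,a_n)'$, let $\alpha>0$ and let $\vartheta$ be real with $|\vartheta|\le 1$. Put $$R_\vartheta=\mathrm{Diag}(1-a_1^2,\dots,1-a_n^2)+\begin{pmatrix}\vec a_1\vec a_1' & \vartheta\,\vec a_1\vec a_2'\\ \vartheta\,\vec a_2\vec a_1' & \vec a_2\vec a_2'\end{pmatrix}.$$ The $\Gamma_n(\alpha,R)$-distribution is the probability measure on $[0,\infty)^n$ with Laplace transform $|I_n+RT|^{-\alpha}$ for all $T=\mathrm{Diag}(t_1,\dots,t_n)$, $t_i\ge 0$. For $\alpha>0$ let $g_\alpha(x)=x^{\alpha-1}e^{-x}/\Gamma(\alpha)$ $(x>0)$ be the standard gamma density, $G_\alpha(x)$ its cdf, and $$G_\alpha(x;y)=e^{-y}\sum_{m=0}^\infty G_{\alpha+m}(x)\frac{y^m}{m!}$$ the non-central gamma cdf. Let ${}_0F_1(\alpha;z)=\sum_{k\ge0}\frac{z^k}{\alpha(\alpha+1)\cdots(\alpha+k-1)\,k!}$,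 let $$L_k^{(\beta)}(y)=\sum_{m=0}^k(-1)^m\binom{k+\beta}{k-m}\frac{y^m}{m!}$$ be the generalized Laguerre polynomials, and for $x_1,\dots,x_n\in\mathbb R$ put $$G_{(1)}(\vec x_1;y)=\prod_{j\le n_1}G_\alpha\Big(\frac{x_j}{1-a_j^2};\frac{a_j^2y}{1-a_j^2}\Big),\qquad G_{(2)}(\vec x_2;y)=\prod_{n_1<j\le n}G_\alpha\Big(\frac{x_j}{1-a_j^2};\frac{a_j^2y}{1-a_j^2}\Big).$$ Then the $\Gamma_n(\alpha,R_\vartheta)$-distribution exists and is unique, and its cdf $F(x_1,\dots,x_n;\alpha,R_\vartheta)$ is given for all $x_1,\dots,x_n$ by the (absolutely convergent) series $$F(x_1,\dots,x_n;\alpha,R_\vartheta)=\sum_{k=0}^\infty\binom{\alpha+k-1}{k}^{-1}\vartheta^{2k}\int_0^\infty G_{(1)}(\vec x_1;y)L_k^{(\alpha-1)}(y)g_\alpha(y)\,dy\int_0^\infty G_{(2)}(\vec x_2;y)L_k^{(\alpha-1)}(y)g_\alpha(y)\,dy .$$ If moreover $|\vartheta|<1$, then also $$F(x_1,\dots,x_n;\alpha,R_\vartheta)=(1-\vartheta^2)^\alpha\int_{(0,\infty)^2}G_{(1)}(\vec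 x_1;(1-\vartheta^2)y_1)\,G_{(2)}(\vec x_2;(1-\vartheta^2)y_2)\,{}_0F_1(\alpha;\vartheta^2y_1y_2)\,g_\alpha(y_1)g_\alpha(y_2)\,dy_1dy_2 .$$ All integrals converge absolutely. -/

import Mathlib

open MeasureTheory ProbabilityTheory Set

namespace MultivariateGamma

/-- The density `g_α(x) = x ^ (α - 1) * exp (-x) / Γ(α)`, `x > 0`, of the univariate standard
gamma distribution. -/
noncomputable def gPdf (α x : ℝ) : ℝ := gammaPDFReal α 1 x

/-- The cdf `G_α(x)` of the univariate standard gamma distribution. -/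
noncomputable def gCdf (α x : ℝ) : ℝ := cdf (gammaMeasure α 1) x

/-- The non-central gamma cdf
`G_α(x; y) = exp (-y) * ∑ₙ G_{α + n}(x) * y ^ n / n!`
with non-centrality parameter `y`. -/
noncomputable def ncCdf (α x y : ℝ) : ℝ :=
  Real.exp (-y) * ∑' n : ℕ, gCdf (α + n) x * (y ^ n / (n.factorial : ℝ))

/-- The hypergeometric function `₀F₁(α; z) = ∑ₖ z ^ k / ((α)ₖ * k!)`, with the rising factorial
`(α)ₖ = α (α + 1) ⋯ (α + k - 1)`. -/
noncomputable def hyp0F1 (α z : ℝ) : ℝ :=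
  ∑' k : ℕ, z ^ k / ((ascPochhammer ℝ k).eval α * (k.factorial : ℝ))

/-- The generalized Laguerre polynomial
`L_k^(β)(y) = ∑_{m ≤ k} (-1) ^ m * binom(k + β, k - m) * y ^ m / m!`. -/
noncomputable def laguerre (β : ℝ) (k : ℕ) (y : ℝ) : ℝ :=
  ∑ m ∈ Finset.range (k + 1),
    (-1) ^ m * Ring.choose ((k : ℝ) + β) (k - m) * (y ^ m / (m.factorial : ℝ))

/-- `μ` is the `Γ_n(α, R)`-distribution: the probability measure on the non-negative orthant
with Laplace transform `det (I + R T) ^ (-α)`, `T = Diag(t₁, …, tₙ)`, `tᵢ ≥ 0`. -/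
structure IsGammaLaw {ι : Type*} [Fintype ι] [DecidableEq ι] (α : ℝ) (R : Matrix ι ι ℝ)
    (μ : Measure (ι → ℝ)) : Prop where
  isProbabilityMeasure : IsProbabilityMeasure μ
  nonneg : ∀ᵐ x ∂μ, ∀ i, 0 ≤ x i
  laplace : ∀ t : ι → ℝ, (∀ i, 0 ≤ t i) →
    ∫ x, Real.exp (-∑ i, t i * x i) ∂μ = (1 + R * Matrix.diagonal t).det ^ (-α)

/-- The joint cdf `F(x₁, …, xₙ) = μ {z | z₁ ≤ x₁, …, zₙ ≤ xₙ}`. -/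
noncomputable def jointCdf {ι : Type*} (μ : Measure (ι → ℝ)) (x : ι → ℝ) : ℝ :=
  μ.real {z | ∀ i, z i ≤ x i}

/-- The two-block correlation matrix
`[D₁ + a₁ a₁ᵀ, ϑ a₁ a₂ᵀ; ϑ a₂ a₁ᵀ, D₂ + a₂ a₂ᵀ]` with `Dᵢ = Diag(…, 1 - a² , …)`. -/
noncomputable def twoBlockCorr {n₁ n₂ : ℕ} (a₁ : Fin n₁ → ℝ) (a₂ : Fin n₂ → ℝ) (ϑ : ℝ) :
    Matrix (Fin n₁ ⊕ Fin n₂) (Fin n₁ ⊕ Fin n₂) ℝ :=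
  Matrix.fromBlocks
    (Matrix.diagonal (fun j => 1 - a₁ j ^ 2) + Matrix.vecMulVec a₁ a₁)
    (ϑ • Matrix.vecMulVec a₁ a₂)
    (ϑ • Matrix.vecMulVec a₂ a₁)
    (Matrix.diagonal (fun j => 1 - a₂ j ^ 2) + Matrix.vecMulVec a₂ a₂)

/-- The product of non-central gamma cdfs
`∏ⱼ G_α((1 - aⱼ²)⁻¹ xⱼ; (1 - aⱼ²)⁻¹ aⱼ² y)` over one block. -/
noncomputable def blockProd {m : ℕ} (α : ℝ) (a x : Fin m → ℝ) (y : ℝ) : ℝ :=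
  ∏ j, ncCdf α ((1 - a j ^ 2)⁻¹ * x j) ((1 - a j ^ 2)⁻¹ * a j ^ 2 * y)

end MultivariateGamma

/-! The distribution is a mixture. Let `(y₁, y₂)` follow Kibble's bivariate gamma law, whose Laplace
transform is `((1 + s)(1 + t) - ϑ² s t) ^ (-α)`, and, given it, let the `x_j` be independent
non-central gamma variables with rate `1 / (1 - a_j²)` and non-centrality `a_j² y / (1 - a_j²)`,
where `y` is `y₁` in the first block and `y₂` in the second. The conditional transform is `∏ (1 + (1
- a_j²) t_j) ^ (-α) * exp (-S₁ y₁ - S₂ y₂)`; averaging evaluates Kibble's transform at `(S₁, S₂)`,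
and a rank-two determinant computation (`det_one_add_twoBlockCorr`) identifies the result as `det (1
+ R T) ^ (-α)`. Uniqueness is Stone–Weierstrass for exponentials (`ext_of_laplace`). Conditional
independence turns the cdf into the integral of `G₍₁₎(y₁) G₍₂₎(y₂)` against Kibble's law
(`jointCdf_twoBlockLaw`).

The series is the Laguerre expansion of that law (`IsKibbleLaw.hasSum_laguerre`). With `γ` the gamma
law, `(f, g) ↦ ∫ f(y₁) g(y₂)` and the diagonal Laguerre form with weights `ϑ ^ (2k)` are continuous
bilinear forms on `L²(γ)`. They agree on exponentials, by Newton's binomial series, and exponentials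
are total. No density is used, so `|ϑ| = 1` is covered. For `|ϑ| < 1` Kibble's law has an explicit
`₀F₁` density up to scaling, which gives the second formula. -/

namespace MultivariateGamma

/-! ### Rising factorials and binomial coefficients. -/

lemma ascPochhammer_eval_succ (a : ℝ) (n : ℕ) :
    (ascPochhammer ℝ (n + 1)).eval a = (ascPochhammer ℝ n).eval a * (a + n) :=
  ascPochhammer_succ_eval n a

lemma Gamma_add_natCast {a : ℝ} (ha : 0 < a) (n : ℕ) :
    Real.Gamma (a + n) = (ascPochhammer ℝ n).eval a * Real.Gamma a := by
  induction n with
  | zero => simp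
  | succ n ih =>
    rw [ascPochhammer_eval_succ, Nat.cast_succ, ← add_assoc, Real.Gamma_add_one (by positivity), ih]
    ring

lemma ascPochhammer_eval_add (a : ℝ) (m n : ℕ) :
    (ascPochhammer ℝ (m + n)).eval a =
      (ascPochhammer ℝ m).eval a * (ascPochhammer ℝ n).eval (a + m) := by
  rw [← ascPochhammer_mul]
  simp

lemma choose_eq_ascPochhammer_div (a : ℝ) (n : ℕ) :
    Ring.choose (a + n - 1) n = (ascPochhammer ℝ n).eval a / n.factorial := by
  have h := Ring.factorial_nsmul_multichoose_eq_ascPochhammer a n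
  rw [Ring.multichoose_eq, Polynomial.ascPochhammer_smeval_eq_eval, nsmul_eq_mul] at h
  rw [← h]
  field_simp

lemma choose_pos {a : ℝ} (ha : 0 < a) (n : ℕ) : 0 < Ring.choose (a + n - 1) n := by
  rw [choose_eq_ascPochhammer_div]
  have := ascPochhammer_pos n a ha
  positivity

/-- Newton's binomial series with a negative exponent. -/
lemma hasSum_choose_mul_pow (a : ℝ) {z : ℝ} (hz : |z| < 1) :
    HasSum (fun k : ℕ => Ring.choose (a + k - 1) k * z ^ k) ((1 - z) ^ (-a)) := by
  have h := (Real.one_div_one_sub_rpow_hasFPowerSeriesOnBall_zero a).hasSum (y := z)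
    (by simpa [← ofReal_norm] using hz)
  have hpos : 0 < 1 - z := by linarith [(abs_lt.mp hz).2]
  rw [zero_add, one_div, ← Real.rpow_neg hpos.le] at h
  simpa [FormalMultilinearSeries.ofScalars, List.prod_ofFn, mul_comm] using h

/-! ### Moments, tilting and scaling of the gamma distribution. -/

/-- Weighting by a power only shifts the shape, and weighting by an exponential (next lemma) only
shifts the rate. All moments and transforms below come from these two facts and total mass one. -/
lemma gammaPDFReal_pow_mul {a r x : ℝ} (ha : 0 < a) (hr : 0 < r) (hx : x ≠ 0) (m : ℕ) :
    gammaPDFReal a r x * x ^ m =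
      (ascPochhammer ℝ m).eval a / r ^ m * gammaPDFReal (a + m) r x := by
  unfold gammaPDFReal
  split_ifs with h
  · have hx' : 0 < x := lt_of_le_of_ne h hx.symm
    have hp := ascPochhammer_pos m a ha
    have hG := Real.Gamma_pos_of_pos ha
    rw [Gamma_add_natCast ha, Real.rpow_add hr, Real.rpow_natCast,
      show a + (m : ℝ) - 1 = (a - 1) + m by ring, Real.rpow_add hx', Real.rpow_natCast]
    field_simp
  · simp

lemma gammaPDFReal_exp_mul {a r s : ℝ} (hr : 0 < r) (hs : 0 < r + s) (x : ℝ) :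
    gammaPDFReal a r x * Real.exp (-(s * x)) =
      (r / (r + s)) ^ a * gammaPDFReal a (r + s) x := by
  unfold gammaPDFReal
  split_ifs with h
  · rw [Real.div_rpow hr.le hs.le, mul_assoc, ← Real.exp_add]
    have : (r + s) ^ a ≠ 0 := (Real.rpow_pos_of_pos hs a).ne'
    rw [show -(r * x) + -(s * x) = -((r + s) * x) by ring]
    field_simp
  · simp

@[fun_prop]
lemma measurable_gammaPDF (a r : ℝ) : Measurable (gammaPDF a r) :=
  (measurable_gammaPDFReal a r).ennreal_ofReal

lemma lintegral_gammaMeasure (a r : ℝ) {f : ℝ → ENNReal} (hf : Measurable f) :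
    ∫⁻ x, f x ∂(gammaMeasure a r) = ∫⁻ x, gammaPDF a r x * f x := by
  rw [gammaMeasure, lintegral_withDensity_eq_lintegral_mul _ (measurable_gammaPDF a r) hf]
  rfl

lemma integral_gammaMeasure {a r : ℝ} (ha : 0 < a) (hr : 0 < r) (f : ℝ → ℝ) :
    ∫ x, f x ∂(gammaMeasure a r) = ∫ x, gammaPDFReal a r x * f x := by
  rw [gammaMeasure, integral_withDensity_eq_integral_toReal_smul (measurable_gammaPDF a r)
    (ae_of_all _ fun x => ENNReal.ofReal_lt_top)]
  simp [gammaPDF, ENNReal.toReal_ofReal (gammaPDFReal_nonneg ha hr _)]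

lemma integrable_gammaMeasure_iff {a r : ℝ} (ha : 0 < a) (hr : 0 < r) (f : ℝ → ℝ) :
    Integrable f (gammaMeasure a r) ↔ Integrable (fun x => gammaPDFReal a r x * f x) := by
  rw [gammaMeasure, integrable_withDensity_iff_integrable_smul₀' (measurable_gammaPDF a r).aemeasurable
    (ae_of_all _ fun x => ENNReal.ofReal_lt_top)]
  simp [gammaPDF, ENNReal.toReal_ofReal (gammaPDFReal_nonneg ha hr _)]

/-- `gammaPDFReal` is supported on `0 ≤ x`, the integrals of the theorem on `0 < x`; the point `0`
is null. -/
lemma gammaPDFReal_mul_eq_indicator (a r : ℝ) (f : ℝ → ℝ) :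
    (fun x => gammaPDFReal a r x * f x) =ᵐ[volume]
      (Ioi (0 : ℝ)).indicator (fun x => f x * gammaPDFReal a r x) := by
  filter_upwards [Measure.ae_ne volume (0 : ℝ)] with x hx
  by_cases h : 0 < x
  · simp [h, mul_comm]
  · have : ¬ 0 ≤ x := fun h' => h (lt_of_le_of_ne h' hx.symm)
    simp [h, gammaPDFReal, this]

lemma integral_gammaMeasure_one {a : ℝ} (ha : 0 < a) (f : ℝ → ℝ) :
    ∫ x, f x ∂(gammaMeasure a 1) = ∫ x in Ioi (0 : ℝ), f x * gPdf a x := by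
  rw [integral_gammaMeasure ha one_pos, integral_congr_ae (gammaPDFReal_mul_eq_indicator a 1 f),
    integral_indicator measurableSet_Ioi]
  rfl

lemma integrable_gammaMeasure_one_iff {a : ℝ} (ha : 0 < a) (f : ℝ → ℝ) :
    Integrable f (gammaMeasure a 1) ↔ IntegrableOn (fun x => f x * gPdf a x) (Ioi (0 : ℝ)) := by
  rw [integrable_gammaMeasure_iff ha one_pos, integrable_congr (gammaPDFReal_mul_eq_indicator a 1 f),
    integrable_indicator_iff measurableSet_Ioi]
  rfl

lemma ae_pos_gammaMeasure (a r : ℝ) : ∀ᵐ x ∂(gammaMeasure a r), 0 < x := by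
  rw [gammaMeasure, ae_withDensity_iff (measurable_gammaPDF a r)]
  filter_upwards [Measure.ae_ne volume (0 : ℝ)] with x hx h
  by_contra hx'
  exact h (gammaPDF_of_neg (lt_of_le_of_ne (not_lt.mp hx') hx))

lemma lintegral_pow_mul_gammaMeasure {a r : ℝ} (ha : 0 < a) (hr : 0 < r) (m : ℕ)
    {f : ℝ → ENNReal} (hf : Measurable f) :
    ∫⁻ x, ENNReal.ofReal (x ^ m) * f x ∂(gammaMeasure a r) =
      ENNReal.ofReal ((ascPochhammer ℝ m).eval a / r ^ m) *
        ∫⁻ x, f x ∂(gammaMeasure (a + m) r) := by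
  have hp := ascPochhammer_pos m a ha
  rw [lintegral_gammaMeasure _ _ hf, lintegral_gammaMeasure _ _ (by fun_prop),
    ← lintegral_const_mul _ (by fun_prop)]
  refine lintegral_congr_ae ?_
  filter_upwards [Measure.ae_ne volume (0 : ℝ)] with x hx
  rw [← mul_assoc, ← mul_assoc, gammaPDF, gammaPDF,
    ← ENNReal.ofReal_mul (gammaPDFReal_nonneg ha hr _), ← ENNReal.ofReal_mul (by positivity),
    gammaPDFReal_pow_mul ha hr hx]

lemma lintegral_exp_gammaMeasure {a r s : ℝ} (ha : 0 < a) (hr : 0 < r) (hs : 0 < r + s) :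
    ∫⁻ x, ENNReal.ofReal (Real.exp (-(s * x))) ∂(gammaMeasure a r) =
      ENNReal.ofReal ((r / (r + s)) ^ a) := by
  rw [lintegral_gammaMeasure _ _ (by fun_prop)]
  calc _ = ∫⁻ x, ENNReal.ofReal ((r / (r + s)) ^ a) * gammaPDF a (r + s) x := by
        refine lintegral_congr fun x => ?_
        rw [gammaPDF, gammaPDF, ← ENNReal.ofReal_mul (gammaPDFReal_nonneg ha hr _),
          ← ENNReal.ofReal_mul (by positivity), gammaPDFReal_exp_mul hr hs]
    _ = _ := by
        rw [lintegral_const_mul _ (by fun_prop), lintegral_gammaPDF_eq_one ha hs, mul_one]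

lemma lintegral_pow_mul_exp_gammaMeasure {a r s : ℝ} (ha : 0 < a) (hr : 0 < r) (hs : 0 < r + s)
    (m : ℕ) :
    ∫⁻ x, ENNReal.ofReal (x ^ m) * ENNReal.ofReal (Real.exp (-(s * x))) ∂(gammaMeasure a r) =
      ENNReal.ofReal ((ascPochhammer ℝ m).eval a / r ^ m * (r / (r + s)) ^ (a + m)) := by
  have hp := ascPochhammer_pos m a ha
  rw [lintegral_pow_mul_gammaMeasure ha hr m (by fun_prop),
    lintegral_exp_gammaMeasure (by positivity) hr hs, ENNReal.ofReal_mul (by positivity)]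

lemma integrable_pow_mul_exp_gammaMeasure {a r s : ℝ} (ha : 0 < a) (hr : 0 < r) (hs : 0 < r + s)
    (m : ℕ) :
    Integrable (fun x => x ^ m * Real.exp (-(s * x))) (gammaMeasure a r) := by
  refine ⟨by fun_prop, ?_⟩
  rw [hasFiniteIntegral_iff_enorm]
  calc _ = ∫⁻ x, ENNReal.ofReal (x ^ m) * ENNReal.ofReal (Real.exp (-(s * x)))
        ∂(gammaMeasure a r) := by
        refine lintegral_congr_ae ?_
        filter_upwards [ae_pos_gammaMeasure a r] with x hx
        rw [Real.enorm_of_nonneg (by positivity), ENNReal.ofReal_mul (by positivity)]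
    _ < ⊤ := by
        rw [lintegral_pow_mul_exp_gammaMeasure ha hr hs]
        exact ENNReal.ofReal_lt_top

lemma integral_pow_mul_exp_gammaMeasure {a r s : ℝ} (ha : 0 < a) (hr : 0 < r) (hs : 0 < r + s)
    (m : ℕ) :
    ∫ x, x ^ m * Real.exp (-(s * x)) ∂(gammaMeasure a r) =
      (ascPochhammer ℝ m).eval a / r ^ m * (r / (r + s)) ^ (a + m) := by
  have hp := ascPochhammer_pos m a ha
  rw [integral_eq_lintegral_of_nonneg_ae]
  · rw [← ENNReal.toReal_ofReal (r := (ascPochhammer ℝ m).eval a / r ^ m * (r / (r + s)) ^ (a + m))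
      (by positivity), ← lintegral_pow_mul_exp_gammaMeasure ha hr hs]
    congr 1
    refine lintegral_congr_ae ?_
    filter_upwards [ae_pos_gammaMeasure a r] with x hx
    rw [ENNReal.ofReal_mul (by positivity)]
  · filter_upwards [ae_pos_gammaMeasure a r] with x hx
    positivity
  · fun_prop

lemma integrable_pow_gammaMeasure {a : ℝ} (ha : 0 < a) (m : ℕ) :
    Integrable (fun x => x ^ m) (gammaMeasure a 1) := by
  simpa using integrable_pow_mul_exp_gammaMeasure ha one_pos (s := 0) (by norm_num) m

lemma integral_pow_gammaMeasure {a : ℝ} (ha : 0 < a) (m : ℕ) :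
    ∫ x, x ^ m ∂(gammaMeasure a 1) = (ascPochhammer ℝ m).eval a := by
  simpa using integral_pow_mul_exp_gammaMeasure ha one_pos (s := 0) (by norm_num) m

lemma gammaMeasure_map_mul {a r : ℝ} (ha : 0 < a) (hr : 0 < r) :
    (gammaMeasure a r).map (fun x => r * x) = gammaMeasure a 1 := by
  ext s hs
  rw [Measure.map_apply (by fun_prop) hs, gammaMeasure, gammaMeasure, withDensity_apply _ hs,
    withDensity_apply _ (hs.preimage (by fun_prop)), ← lintegral_indicator hs,
    ← lintegral_indicator (hs.preimage (by fun_prop))]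
  have h := Real.map_volume_mul_left hr.ne'
  rw [← one_smul ENNReal (volume : Measure ℝ)]
  -- Lebesgue measure is `r` times its own image under `x ↦ r * x`; rewriting only the right-hand
  -- side this way performs the change of variables.
  have h2 : (1 : ENNReal) • (volume : Measure ℝ) =
      ENNReal.ofReal r • (Measure.map (fun x => r * x) volume) := by
    rw [h, smul_smul, ← ENNReal.ofReal_mul hr.le, abs_of_pos (inv_pos.mpr hr),
      mul_inv_cancel₀ hr.ne', ENNReal.ofReal_one]
  conv_rhs => rw [h2, lintegral_smul_measure,
    lintegral_map ((measurable_gammaPDF a 1).indicator hs) (by fun_prop)]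
  rw [one_smul, smul_eq_mul,
    ← lintegral_const_mul _ (f := fun x => s.indicator (gammaPDF a 1) (r * x))
      (((measurable_gammaPDF a 1).indicator hs).comp (by fun_prop))]
  refine lintegral_congr_ae ?_
  filter_upwards [Measure.ae_ne volume (0 : ℝ)] with x hx
  by_cases hxs : r * x ∈ s
  · rw [indicator_of_mem (show x ∈ (fun x => r * x) ⁻¹' s from hxs), indicator_of_mem hxs,
      gammaPDF, gammaPDF, ← ENNReal.ofReal_mul hr.le]
    congr 1
    unfold gammaPDFReal
    by_cases h0 : 0 ≤ x
    · have hx0 : 0 < x := lt_of_le_of_ne h0 hx.symm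
      rw [if_pos h0, if_pos (by positivity), Real.mul_rpow hr.le hx0.le, Real.one_rpow,
        Real.rpow_sub_one hr.ne']
      field_simp
    · rw [if_neg h0, if_neg (by rw [mul_nonneg_iff_of_pos_left hr]; exact h0), mul_zero]
  · rw [indicator_of_notMem (show x ∉ (fun x => r * x) ⁻¹' s from hxs), indicator_of_notMem hxs,
      mul_zero]

lemma gammaMeasure_Iic {a r : ℝ} (ha : 0 < a) (hr : 0 < r) (x : ℝ) :
    gammaMeasure a r (Iic x) = ENNReal.ofReal (gCdf a (r * x)) := by
  have := isProbabilityMeasure_gammaMeasure ha one_pos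
  rw [gCdf, ofReal_cdf, ← gammaMeasure_map_mul ha hr,
    Measure.map_apply (by fun_prop) measurableSet_Iic]
  congr 1
  ext y
  simp [mul_le_mul_iff_right₀ hr]

/-! ### Uniqueness of Laplace transforms. -/

/-- Finite measures are determined by their integrals over a multiplicative separating family of
bounded continuous functions. -/
lemma ext_of_submonoid_integral_eq {E : Type*} [MeasurableSpace E] [TopologicalSpace E]
    [PolishSpace E] [BorelSpace E] {P P' : Measure E} [IsFiniteMeasure P] [IsFiniteMeasure P']
    (M : Submonoid (BoundedContinuousFunction E ℝ))
    (hM : ∀ x y : E, x ≠ y → ∃ f ∈ M, f x ≠ f y)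
    (h : ∀ f ∈ M, ∫ x, f x ∂P = ∫ x, f x ∂P') : P = P' := by
  -- The algebra generated by a multiplicative family is its linear span, so equality of integrals
  -- passes to the whole subalgebra by linearity.
  have hspan : ∀ g ∈ Submodule.span ℝ (M : Set (BoundedContinuousFunction E ℝ)),
      ∫ x, g x ∂P = ∫ x, g x ∂P' := by
    intro g hg
    induction hg using Submodule.span_induction with
    | mem f hf => exact h f hf
    | zero => simp
    | add f g _ _ ihf ihg =>
      simp only [BoundedContinuousFunction.coe_add, Pi.add_apply]
      rw [integral_add (BoundedContinuousFunction.integrable P f)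
        (BoundedContinuousFunction.integrable P g),
        integral_add (BoundedContinuousFunction.integrable P' f)
        (BoundedContinuousFunction.integrable P' g), ihf, ihg]
    | smul c f _ ihf =>
      simp only [BoundedContinuousFunction.coe_smul, smul_eq_mul]
      rw [integral_const_mul, integral_const_mul, ihf]
  let A : StarSubalgebra ℝ (BoundedContinuousFunction E ℝ) :=
    { toSubalgebra := Algebra.adjoin ℝ (M : Set (BoundedContinuousFunction E ℝ))
      star_mem' := fun {f} hf => by
        have : star f = f := by ext; simp
        rwa [this] }
  refine ext_of_forall_mem_subalgebra_integral_eq_of_polish (𝕜 := ℝ) (A := A) ?_ ?_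
  · intro x y hxy
    obtain ⟨f, hf, hne⟩ := hM x y hxy
    refine ⟨f, ⟨BoundedContinuousFunction.toContinuousMapStarₐ ℝ f, ?_, rfl⟩, hne⟩
    exact ⟨f, Algebra.subset_adjoin hf, rfl⟩
  · intro g hg
    refine hspan g ?_
    have : g ∈ Subalgebra.toSubmodule
        (Algebra.adjoin ℝ (M : Set (BoundedContinuousFunction E ℝ))) := hg
    rwa [Algebra.adjoin_eq_span, Submonoid.closure_eq] at this

/-- The exponential `x ↦ exp (-∑ tᵢ xᵢ)` on the orthant, as a bounded continuous function. -/
noncomputable def orthantExp {ι : Type*} [Fintype ι] (t : ι → NNReal) :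
    BoundedContinuousFunction (ι → NNReal) ℝ :=
  BoundedContinuousFunction.ofNormedAddCommGroup
    (fun x => Real.exp (-∑ i, (t i : ℝ) * x i)) (by fun_prop) 1 (fun x => by
      rw [Real.norm_eq_abs, Real.abs_exp, Real.exp_le_one_iff, neg_nonpos]
      positivity)

lemma orthantExp_apply {ι : Type*} [Fintype ι] (t x : ι → NNReal) :
    orthantExp t x = Real.exp (-∑ i, (t i : ℝ) * x i) := rfl

/-- Uniqueness of the multivariate Laplace transform on the orthant. -/
lemma ext_of_laplace {ι : Type*} [Fintype ι] {P P' : Measure (ι → ℝ)} [IsFiniteMeasure P]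
    [IsFiniteMeasure P'] (hP : ∀ᵐ x ∂P, ∀ i, 0 ≤ x i) (hP' : ∀ᵐ x ∂P', ∀ i, 0 ≤ x i)
    (h : ∀ t : ι → ℝ, (∀ i, 0 ≤ t i) →
      ∫ x, Real.exp (-∑ i, t i * x i) ∂P = ∫ x, Real.exp (-∑ i, t i * x i) ∂P') : P = P' := by
  classical
  -- Exponentials are bounded only on the orthant, so both measures are transported to `ι → NNReal`;
  -- nothing is lost, as they are concentrated there.
  let φ : (ι → ℝ) → (ι → NNReal) := fun x i => (x i).toNNReal
  let ψ : (ι → NNReal) → (ι → ℝ) := fun x i => x i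
  have hφ : Measurable φ := by fun_prop
  have hψ : Measurable ψ := by fun_prop
  have recover : ∀ Q : Measure (ι → ℝ), (∀ᵐ x ∂Q, ∀ i, 0 ≤ x i) → (Q.map φ).map ψ = Q := by
    intro Q hQ
    rw [Measure.map_map hψ hφ]
    conv_rhs => rw [← Measure.map_id (μ := Q)]
    refine Measure.map_congr ?_
    filter_upwards [hQ] with x hx
    funext i
    simp [φ, ψ, hx i]
  have int_eq : ∀ Q : Measure (ι → ℝ), (∀ᵐ x ∂Q, ∀ i, 0 ≤ x i) → ∀ t : ι → NNReal,
      ∫ x, orthantExp t x ∂(Q.map φ) = ∫ x, Real.exp (-∑ i, (t i : ℝ) * x i) ∂Q := by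
    intro Q hQ t
    rw [integral_map hφ.aemeasurable (orthantExp t).continuous.aestronglyMeasurable]
    refine integral_congr_ae ?_
    filter_upwards [hQ] with x hx
    rw [orthantExp_apply]
    congr 2
    refine Finset.sum_congr rfl fun i _ => ?_
    rw [Real.coe_toNNReal _ (hx i)]
  rw [← recover P hP, ← recover P' hP']
  congr 1
  let M : Submonoid (BoundedContinuousFunction (ι → NNReal) ℝ) :=
    { carrier := range orthantExp
      one_mem' := ⟨0, by ext x; simp [orthantExp_apply]⟩
      mul_mem' := by
        rintro _ _ ⟨s, rfl⟩ ⟨t, rfl⟩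
        refine ⟨s + t, ?_⟩
        ext x
        simp only [orthantExp_apply, BoundedContinuousFunction.coe_mul, Pi.mul_apply, Pi.add_apply,
          NNReal.coe_add]
        rw [← Real.exp_add, ← neg_add, ← Finset.sum_add_distrib]
        congr 2
        exact Finset.sum_congr rfl fun i _ => by ring }
  refine ext_of_submonoid_integral_eq M ?_ ?_
  · intro x y hxy
    obtain ⟨i, hi⟩ := Function.ne_iff.mp hxy
    refine ⟨_, ⟨Pi.single i 1, rfl⟩, ?_⟩
    simp only [orthantExp_apply, ne_eq, Real.exp_eq_exp, neg_inj]
    have key : ∀ z : ι → NNReal,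
        ∑ j, ((Pi.single i 1 : ι → NNReal) j : ℝ) * (z j : ℝ) = z i := by
      intro z
      rw [Finset.sum_eq_single i]
      · simp
      · intro j _ hj
        simp [hj]
      · simp
    rw [key, key]
    exact_mod_cast hi
  · rintro _ ⟨t, rfl⟩
    rw [int_eq P hP, int_eq P' hP']
    exact h _ fun i => (t i).2

/-- Uniqueness of the Laplace transform on the half-line. -/
lemma ext_of_laplace_real {P P' : Measure ℝ} [IsFiniteMeasure P] [IsFiniteMeasure P']
    (hP : ∀ᵐ x ∂P, 0 ≤ x) (hP' : ∀ᵐ x ∂P', 0 ≤ x)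
    (h : ∀ s : ℝ, 0 ≤ s →
      ∫ x, Real.exp (-(s * x)) ∂P = ∫ x, Real.exp (-(s * x)) ∂P') : P = P' := by
  let e := MeasurableEquiv.funUnique Unit ℝ
  have hmeas : ∀ t : Unit → ℝ,
      Measurable fun x : Unit → ℝ => Real.exp (-∑ i, t i * x i) := by
    intro t
    fun_prop
  have key : P.map e.symm = P'.map e.symm := by
    refine ext_of_laplace ?_ ?_ ?_
    · rw [ae_map_iff e.symm.measurable.aemeasurable (by measurability)]
      filter_upwards [hP] with x hx i
      exact hx
    · rw [ae_map_iff e.symm.measurable.aemeasurable (by measurability)]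
      filter_upwards [hP'] with x hx i
      exact hx
    · intro t ht
      rw [integral_map e.symm.measurable.aemeasurable (hmeas t).aestronglyMeasurable,
        integral_map e.symm.measurable.aemeasurable (hmeas t).aestronglyMeasurable]
      have he : ∀ x : ℝ, e.symm x PUnit.unit = x := fun _ => rfl
      simpa [he] using h (t ()) (ht ())
  have := congrArg (Measure.map e) key
  rwa [Measure.map_map e.measurable e.symm.measurable,
    Measure.map_map e.measurable e.symm.measurable, e.self_comp_symm, Measure.map_id,
    Measure.map_id] at this

/-! ### Totality of exponentials in `L²`. -/

/-- The elements of `L²(γ)` represented by an exponential `x ↦ exp (-s x)`, `s ≥ 0`. -/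
def expClasses (γ : Measure ℝ) : Set (Lp ℝ 2 γ) :=
  {g | ∃ s : ℝ, 0 ≤ s ∧ g =ᵐ[γ] fun x => Real.exp (-(s * x))}

lemma norm_exp_neg_mul_le {s x : ℝ} (hs : 0 ≤ s) (hx : 0 ≤ x) : ‖Real.exp (-(s * x))‖ ≤ 1 := by
  rw [Real.norm_eq_abs, Real.abs_exp, Real.exp_le_one_iff, neg_nonpos]
  positivity

lemma memLp_exp {γ : Measure ℝ} [IsFiniteMeasure γ] (hγ : ∀ᵐ x ∂γ, 0 ≤ x) {s : ℝ} (hs : 0 ≤ s)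
    (p : ENNReal) : MemLp (fun x => Real.exp (-(s * x))) p γ := by
  refine MemLp.of_bound (by fun_prop) 1 ?_
  filter_upwards [hγ] with x hx
  exact norm_exp_neg_mul_le hs hx

/-- Exponentials are total in `L²` of a finite measure on the half-line. -/
lemma dense_span_expClasses {γ : Measure ℝ} [IsFiniteMeasure γ] (hγ : ∀ᵐ x ∂γ, 0 ≤ x) :
    Dense (Submodule.span ℝ (expClasses γ) : Set (Lp ℝ 2 γ)) := by
  rw [Submodule.dense_iff_topologicalClosure_eq_top, Submodule.topologicalClosure_eq_top_iff,
    Submodule.eq_bot_iff]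
  intro f hf
  have hfL : MemLp f 2 γ := Lp.memLp f
  have hfi : Integrable f γ := hfL.integrable one_le_two
  have h0 : ∀ s : ℝ, 0 ≤ s → ∫ x, Real.exp (-(s * x)) * f x ∂γ = 0 := by
    intro s hs
    have hm := memLp_exp hγ hs 2
    have hmem : hm.toLp ∈ expClasses γ := ⟨s, hs, hm.coeFn_toLp⟩
    have := (Submodule.mem_orthogonal _ _).mp hf _ (Submodule.subset_span hmem)
    rw [L2.inner_def] at this
    rw [← this]
    refine integral_congr_ae ?_
    filter_upwards [hm.coeFn_toLp] with x hx
    simp [hx, mul_comm]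
  -- If `f` is orthogonal to every exponential, the finite measures with densities `f⁺` and `f⁻`
  -- have the same Laplace transform. Hence `f⁺ = f⁻` a.e., which forces `f = 0`.
  let P := γ.withDensity fun x => ENNReal.ofReal (f x)
  let P' := γ.withDensity fun x => ENNReal.ofReal (-f x)
  have fP : IsFiniteMeasure P := isFiniteMeasure_withDensity_ofReal hfi.2
  have fP' : IsFiniteMeasure P' := isFiniteMeasure_withDensity_ofReal hfi.neg.2
  have haf : AEMeasurable (fun x => ENNReal.ofReal (f x)) γ := hfi.aemeasurable.ennreal_ofReal
  have haf' : AEMeasurable (fun x => ENNReal.ofReal (-f x)) γ :=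
    hfi.aemeasurable.neg.ennreal_ofReal
  have hPP : P = P' := by
    refine ext_of_laplace_real ((withDensity_absolutelyContinuous _ _).ae_le hγ)
      ((withDensity_absolutelyContinuous _ _).ae_le hγ) ?_
    intro s hs
    rw [integral_withDensity_eq_integral_toReal_smul₀ haf (ae_of_all _ fun _ => ENNReal.ofReal_lt_top),
      integral_withDensity_eq_integral_toReal_smul₀ haf' (ae_of_all _ fun _ => ENNReal.ofReal_lt_top),
      ← sub_eq_zero]
    have hb : ∀ g : ℝ → ℝ, Integrable g γ →
        Integrable (fun x => (ENNReal.ofReal (g x)).toReal • Real.exp (-(s * x))) γ := by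
      intro g hg
      have h1 : Integrable (fun x => (ENNReal.ofReal (g x)).toReal) γ := by
        refine hg.mono hg.aemeasurable.ennreal_ofReal.ennreal_toReal.aestronglyMeasurable
          (ae_of_all _ fun x => ?_)
        rw [ENNReal.toReal_ofReal', Real.norm_eq_abs, Real.norm_eq_abs, abs_of_nonneg (by simp)]
        exact max_le (le_abs_self _) (abs_nonneg _)
      refine h1.mul_bdd (c := 1) (by fun_prop) ?_
      filter_upwards [hγ] with x hx
      exact norm_exp_neg_mul_le hs hx
    rw [← integral_sub (hb f hfi) (hb (fun x => -f x) hfi.neg), ← h0 s hs]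
    refine integral_congr_ae (ae_of_all _ fun x => ?_)
    simp only [ENNReal.toReal_ofReal', smul_eq_mul]
    rcases le_total 0 (f x) with hx | hx
    · rw [max_eq_left hx, max_eq_right (by linarith)]; ring
    · rw [max_eq_right hx, max_eq_left (by linarith)]; ring
  have hae := (withDensity_eq_iff haf haf' hfi.lintegral_lt_top.ne).mp hPP
  refine (Lp.eq_zero_iff_ae_eq_zero).mpr ?_
  filter_upwards [hae] with x hx
  by_contra hne
  rcases lt_or_gt_of_ne hne with h | h
  · rw [ENNReal.ofReal_of_nonpos h.le, eq_comm, ENNReal.ofReal_eq_zero] at hx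
    simp only [Pi.zero_apply] at h
    linarith
  · simp only [Pi.zero_apply] at h
    rw [ENNReal.ofReal_of_nonpos (p := -f x) (by linarith), ENNReal.ofReal_eq_zero] at hx
    linarith

/-! ### Laguerre polynomials: transforms and orthogonality. -/

/-- The denominators `(α)ₘ` exposed here cancel against the gamma moments, so that integrals of
Laguerre polynomials become alternating binomial sums. -/
lemma laguerre_eq {α : ℝ} (hα : 0 < α) (k : ℕ) (y : ℝ) :
    laguerre (α - 1) k y = ∑ m ∈ Finset.range (k + 1),
      Ring.choose (α + k - 1) k * ((-1) ^ m * (k.choose m : ℝ) / (ascPochhammer ℝ m).eval α) *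
        y ^ m := by
  unfold laguerre
  refine Finset.sum_congr rfl fun m hm => ?_
  have hmk : m ≤ k := Nat.lt_succ_iff.mp (Finset.mem_range.mp hm)
  have hc : Ring.choose ((k : ℝ) + (α - 1)) (k - m) =
      (ascPochhammer ℝ (k - m)).eval (α + m) / (k - m).factorial := by
    rw [← choose_eq_ascPochhammer_div]
    congr 1
    rw [Nat.cast_sub hmk]
    ring
  have hp := ascPochhammer_eval_add α m (k - m)
  rw [Nat.add_sub_cancel' hmk] at hp
  rw [hc, choose_eq_ascPochhammer_div, hp, Nat.cast_choose ℝ hmk]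
  have := ascPochhammer_pos m α hα
  field_simp

lemma sum_choose_mul_pow_sub {x : ℝ} (k : ℕ) :
    ∑ m ∈ Finset.range (k + 1), (-1) ^ m * (k.choose m : ℝ) * x ^ m = (1 - x) ^ k := by
  rw [show (1 - x) = (-x) + 1 by ring, add_pow]
  refine Finset.sum_congr rfl fun m _ => ?_
  rw [neg_pow, one_pow]
  ring

/-- Once the moments have cancelled, the binomial theorem sums the powers of `1 / (1 + s)`. The
dependence on `k` is geometric up to the binomial factor, which makes the expansion summable in
closed form. -/
lemma integral_laguerre_mul_exp {α s : ℝ} (hα : 0 < α) (hs : 0 ≤ s) (k : ℕ) :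
    ∫ y, laguerre (α - 1) k y * Real.exp (-(s * y)) ∂(gammaMeasure α 1) =
      Ring.choose (α + k - 1) k * (1 + s) ^ (-α) * (s / (1 + s)) ^ k := by
  have hs1 : 0 < 1 + s := by linarith
  simp_rw [laguerre_eq hα, Finset.sum_mul, mul_assoc _ (_ ^ _) (Real.exp _)]
  rw [integral_finsetSum _ fun m _ =>
    (integrable_pow_mul_exp_gammaMeasure hα one_pos hs1 m).const_mul _]
  simp_rw [integral_const_mul, integral_pow_mul_exp_gammaMeasure hα one_pos hs1]
  have h1 : s / (1 + s) = 1 - 1 / (1 + s) := by field_simp; ring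
  rw [h1, ← sum_choose_mul_pow_sub, Finset.mul_sum]
  refine Finset.sum_congr rfl fun m _ => ?_
  have := ascPochhammer_pos m α hα
  rw [Real.rpow_add (by positivity), Real.rpow_natCast, Real.rpow_neg hs1.le,
    Real.div_rpow zero_le_one hs1.le, Real.one_rpow, one_pow]
  field_simp

/-- Up to sign the sum is the `k`-th finite difference at `0`, and that annihilates polynomials of
degree below `k`. -/
lemma sum_choose_mul_eval_eq_zero (P : Polynomial ℝ) {k : ℕ} (hP : P.natDegree < k) :
    ∑ m ∈ Finset.range (k + 1), (-1) ^ m * (k.choose m : ℝ) * P.eval (m : ℝ) = 0 := by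
  have h := congrFun (Polynomial.fwdDiff_iter_eq_zero_of_degree_lt hP) (0 : ℝ)
  rw [fwdDiff_iter_eq_sum_shift] at h
  have h2 := congrArg (fun z => (-1 : ℝ) ^ k * z) h
  simp only [Pi.zero_apply, mul_zero, Finset.mul_sum] at h2
  rw [← h2]
  refine Finset.sum_congr rfl fun m hm => ?_
  have hmk : m ≤ k := Nat.lt_succ_iff.mp (Finset.mem_range.mp hm)
  have hsign : (-1 : ℝ) ^ k * (-1) ^ (k - m) = (-1) ^ m := by
    rw [← pow_add, show k + (k - m) = 2 * (k - m) + m by omega, pow_add, pow_mul]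
    simp
  simp only [zsmul_eq_mul, Int.cast_mul, Int.cast_pow, Int.cast_neg, Int.cast_one,
    Int.cast_natCast, zero_add, nsmul_eq_mul, mul_one]
  rw [← hsign]
  ring

lemma sum_choose_mul_eval_eq_factorial (P : Polynomial ℝ) (hP : P.Monic) :
    ∑ m ∈ Finset.range (P.natDegree + 1),
      (-1) ^ m * (P.natDegree.choose m : ℝ) * P.eval (m : ℝ) =
        (-1) ^ P.natDegree * P.natDegree.factorial := by
  have h := congrFun (Polynomial.fwdDiff_iter_degree_eq_factorial P) (0 : ℝ)
  rw [fwdDiff_iter_eq_sum_shift, hP.leadingCoeff, one_smul] at h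
  have h2 := congrArg (fun z => (-1 : ℝ) ^ P.natDegree * z) h
  simp only [Finset.mul_sum, Pi.natCast_apply] at h2
  convert h2 using 1
  refine Finset.sum_congr rfl fun m hm => ?_
  have hmk : m ≤ P.natDegree := Nat.lt_succ_iff.mp (Finset.mem_range.mp hm)
  have hsign : (-1 : ℝ) ^ P.natDegree * (-1) ^ (P.natDegree - m) = (-1) ^ m := by
    rw [← pow_add, show P.natDegree + (P.natDegree - m) = 2 * (P.natDegree - m) + m by omega,
      pow_add, pow_mul]
    simp
  simp only [zsmul_eq_mul, Int.cast_mul, Int.cast_pow, Int.cast_neg, Int.cast_one,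
    Int.cast_natCast, zero_add, nsmul_eq_mul, mul_one]
  rw [← hsign]
  ring

/-- The moment `(α)ₘ₊ⱼ` splits as `(α)ₘ (α + m)ⱼ`; after cancellation the summand is a monic
polynomial of degree `j` in `m`, and finite differences apply. -/
lemma integral_laguerre_mul_pow {α : ℝ} (hα : 0 < α) (k j : ℕ) :
    ∫ y, laguerre (α - 1) k y * y ^ j ∂(gammaMeasure α 1) =
      Ring.choose (α + k - 1) k * ∑ m ∈ Finset.range (k + 1), (-1) ^ m * (k.choose m : ℝ) *
        ((ascPochhammer ℝ j).comp (Polynomial.X + Polynomial.C α)).eval (m : ℝ) := by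
  simp_rw [laguerre_eq hα, Finset.sum_mul, mul_assoc _ (_ ^ _) (_ ^ j), ← pow_add]
  rw [integral_finsetSum _ fun m _ => (integrable_pow_gammaMeasure hα _).const_mul _]
  simp_rw [integral_const_mul, integral_pow_gammaMeasure hα, Finset.mul_sum]
  refine Finset.sum_congr rfl fun m _ => ?_
  have := ascPochhammer_pos m α hα
  simp only [ascPochhammer_eval_add, Polynomial.eval_comp, Polynomial.eval_add, Polynomial.eval_X,
    Polynomial.eval_C]
  rw [add_comm (m : ℝ) α]
  field_simp

lemma natDegree_ascPochhammer_comp (α : ℝ) (j : ℕ) :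
    ((ascPochhammer ℝ j).comp (Polynomial.X + Polynomial.C α)).natDegree = j := by
  rw [Polynomial.natDegree_comp, Polynomial.natDegree_X_add_C, ascPochhammer_natDegree, mul_one]

lemma integral_laguerre_mul_pow_of_lt {α : ℝ} (hα : 0 < α) {k j : ℕ} (hjk : j < k) :
    ∫ y, laguerre (α - 1) k y * y ^ j ∂(gammaMeasure α 1) = 0 := by
  rw [integral_laguerre_mul_pow hα, sum_choose_mul_eval_eq_zero _
    (by rwa [natDegree_ascPochhammer_comp]), mul_zero]

lemma integral_laguerre_mul_pow_self {α : ℝ} (hα : 0 < α) (k : ℕ) :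
    ∫ y, laguerre (α - 1) k y * y ^ k ∂(gammaMeasure α 1) =
      Ring.choose (α + k - 1) k * ((-1) ^ k * k.factorial) := by
  have h := sum_choose_mul_eval_eq_factorial
    ((ascPochhammer ℝ k).comp (Polynomial.X + Polynomial.C α))
    ((monic_ascPochhammer ℝ k).comp_X_add_C α)
  rw [natDegree_ascPochhammer_comp] at h
  rw [integral_laguerre_mul_pow hα, h]

lemma memLp_pow_gammaMeasure {α : ℝ} (hα : 0 < α) (m : ℕ) :
    MemLp (fun y : ℝ => y ^ m) 2 (gammaMeasure α 1) := by
  rw [memLp_two_iff_integrable_sq (by fun_prop)]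
  simp_rw [← pow_mul]
  exact integrable_pow_gammaMeasure hα _

lemma memLp_laguerre {α : ℝ} (hα : 0 < α) (k : ℕ) :
    MemLp (laguerre (α - 1) k) 2 (gammaMeasure α 1) := by
  rw [show laguerre (α - 1) k = fun y => _ from funext (laguerre_eq hα k)]
  exact memLp_finsetSum _ fun m _ => (memLp_pow_gammaMeasure hα m).const_mul _

lemma integral_laguerre_mul_laguerre_of_lt {α : ℝ} (hα : 0 < α) {k j : ℕ} (hjk : j < k) :
    ∫ y, laguerre (α - 1) k y * laguerre (α - 1) j y ∂(gammaMeasure α 1) = 0 := by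
  simp_rw [laguerre_eq hα j, Finset.mul_sum]
  rw [integral_finsetSum]
  · refine Finset.sum_eq_zero fun m hm => ?_
    simp_rw [mul_left_comm (laguerre _ _ _)]
    rw [integral_const_mul, integral_laguerre_mul_pow_of_lt hα
      (lt_of_lt_of_le (Finset.mem_range.mp hm) hjk), mul_zero]
  · intro m _
    exact (memLp_laguerre hα k).integrable_mul ((memLp_pow_gammaMeasure hα m).const_mul _)

lemma integral_laguerre_mul_self {α : ℝ} (hα : 0 < α) (k : ℕ) :
    ∫ y, laguerre (α - 1) k y * laguerre (α - 1) k y ∂(gammaMeasure α 1) =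
      Ring.choose (α + k - 1) k := by
  have h : ∀ y, laguerre (α - 1) k y * laguerre (α - 1) k y = ∑ m ∈ Finset.range (k + 1),
      laguerre (α - 1) k y * (Ring.choose (α + k - 1) k *
        ((-1) ^ m * (k.choose m : ℝ) / (ascPochhammer ℝ m).eval α) * y ^ m) := by
    intro y
    rw [← Finset.mul_sum, ← laguerre_eq hα k y]
  simp_rw [h]
  -- Only the leading term `m = k` survives orthogonality to lower powers.
  rw [integral_finsetSum, Finset.sum_range_succ, Finset.sum_eq_zero, zero_add]
  · simp_rw [mul_left_comm (laguerre _ _ _)]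
    have := ascPochhammer_pos k α hα
    rw [integral_const_mul, integral_laguerre_mul_pow_self hα, choose_eq_ascPochhammer_div]
    field_simp
    simp [← pow_mul]
  · intro m hm
    simp_rw [mul_left_comm (laguerre _ _ _)]
    rw [integral_const_mul, integral_laguerre_mul_pow_of_lt hα (Finset.mem_range.mp hm), mul_zero]
  · intro m _
    exact (memLp_laguerre hα k).integrable_mul ((memLp_pow_gammaMeasure hα m).const_mul _)

/-- The orthonormalized Laguerre polynomials in `L²` of the gamma distribution. -/
noncomputable def laguerreLp {α : ℝ} (hα : 0 < α) (k : ℕ) : Lp ℝ 2 (gammaMeasure α 1) :=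
  (Real.sqrt (Ring.choose (α + k - 1) k))⁻¹ • (memLp_laguerre hα k).toLp

lemma inner_laguerreLp {α : ℝ} (hα : 0 < α) (k : ℕ) {f : ℝ → ℝ} {g : Lp ℝ 2 (gammaMeasure α 1)}
    (hg : g =ᵐ[gammaMeasure α 1] f) :
    inner ℝ (laguerreLp hα k) g = (Real.sqrt (Ring.choose (α + k - 1) k))⁻¹ *
      ∫ y, laguerre (α - 1) k y * f y ∂(gammaMeasure α 1) := by
  rw [laguerreLp, inner_smul_left, L2.inner_def]
  simp only [conj_trivial]
  congr 1
  refine integral_congr_ae ?_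
  filter_upwards [(memLp_laguerre hα k).coeFn_toLp, hg] with y h1 h2
  simp [h1, h2, mul_comm]

lemma orthonormal_laguerreLp {α : ℝ} (hα : 0 < α) : Orthonormal ℝ (laguerreLp hα) := by
  have key : ∀ k j, inner ℝ (laguerreLp hα k) (laguerreLp hα j) =
      (Real.sqrt (Ring.choose (α + j - 1) j))⁻¹ * ((Real.sqrt (Ring.choose (α + k - 1) k))⁻¹ *
        ∫ y, laguerre (α - 1) k y * laguerre (α - 1) j y ∂(gammaMeasure α 1)) := by
    intro k j
    conv_lhs => rw [laguerreLp.eq_1 hα j]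
    rw [inner_smul_right, inner_laguerreLp hα k (memLp_laguerre hα j).coeFn_toLp]
  rw [orthonormal_iff_ite]
  intro k j
  rw [key]
  split_ifs with h
  · subst h
    rw [integral_laguerre_mul_self hα]
    have := choose_pos hα k
    rw [← mul_assoc, ← mul_inv, Real.mul_self_sqrt this.le, inv_mul_cancel₀ this.ne']
  · rcases lt_or_gt_of_ne h with h | h
    · simp_rw [mul_comm (laguerre _ k _)]
      rw [integral_laguerre_mul_laguerre_of_lt hα h]
      simp
    · rw [integral_laguerre_mul_laguerre_of_lt hα h]
      simp

/-! ### Diagonal bilinear forms of an orthonormal sequence. -/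

section WeightedForm

variable {E : Type*} [NormedAddCommGroup E] [InnerProductSpace ℝ E]

/-- Cauchy–Schwarz followed by Bessel's inequality for each factor; completeness of the sequence
plays no role. -/
lemma sum_abs_weighted_inner_le {e : ℕ → E} (he : Orthonormal ℝ e) {w : ℕ → ℝ}
    (hw : ∀ k, |w k| ≤ 1) (f g : E) (s : Finset ℕ) :
    ∑ k ∈ s, |w k * (inner ℝ (e k) f * inner ℝ (e k) g)| ≤ ‖f‖ * ‖g‖ := by
  calc ∑ k ∈ s, |w k * (inner ℝ (e k) f * inner ℝ (e k) g)|
      ≤ ∑ k ∈ s, |inner ℝ (e k) f| * |inner ℝ (e k) g| := by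
        refine Finset.sum_le_sum fun k _ => ?_
        rw [abs_mul, abs_mul]
        exact mul_le_of_le_one_left (by positivity) (hw k)
    _ ≤ ‖f‖ * ‖g‖ := by
        refine abs_le_of_sq_le_sq' ?_ (by positivity) |>.2
        refine (Finset.sum_mul_sq_le_sq_mul_sq _ _ _).trans ?_
        rw [mul_pow]
        exact mul_le_mul (he.sum_inner_products_le f) (he.sum_inner_products_le g)
          (by positivity) (by positivity)

lemma summable_weighted_inner {e : ℕ → E} (he : Orthonormal ℝ e) {w : ℕ → ℝ}
    (hw : ∀ k, |w k| ≤ 1) (f g : E) :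
    Summable fun k => w k * (inner ℝ (e k) f * inner ℝ (e k) g) := by
  refine Summable.of_abs ?_
  exact summable_of_sum_le (fun k => abs_nonneg _) (sum_abs_weighted_inner_le he hw f g)

lemma abs_tsum_weighted_inner_le {e : ℕ → E} (he : Orthonormal ℝ e) {w : ℕ → ℝ}
    (hw : ∀ k, |w k| ≤ 1) (f g : E) :
    |∑' k, w k * (inner ℝ (e k) f * inner ℝ (e k) g)| ≤ ‖f‖ * ‖g‖ := by
  have h := summable_weighted_inner he hw f g
  rw [← Real.norm_eq_abs]
  refine (norm_tsum_le_tsum_norm h.norm).trans ?_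
  refine h.norm.tsum_le_of_sum_le fun s => ?_
  simpa only [Real.norm_eq_abs] using sum_abs_weighted_inner_le he hw f g s

/-- The bilinear form `(f, g) ↦ ∑ₖ wₖ ⟪eₖ, f⟫ ⟪eₖ, g⟫` of an orthonormal sequence. -/
noncomputable def weightedBilin {e : ℕ → E} (he : Orthonormal ℝ e) {w : ℕ → ℝ}
    (hw : ∀ k, |w k| ≤ 1) : E →ₗ[ℝ] E →ₗ[ℝ] ℝ :=
  LinearMap.mk₂ ℝ (fun f g => ∑' k, w k * (inner ℝ (e k) f * inner ℝ (e k) g))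
    (fun f f' g => by
      rw [← (summable_weighted_inner he hw f g).tsum_add (summable_weighted_inner he hw f' g)]
      refine tsum_congr fun k => ?_
      rw [inner_add_right]; ring)
    (fun c f g => by
      rw [smul_eq_mul, ← tsum_mul_left]
      refine tsum_congr fun k => ?_
      rw [inner_smul_right]; ring)
    (fun f g g' => by
      rw [← (summable_weighted_inner he hw f g).tsum_add (summable_weighted_inner he hw f g')]
      refine tsum_congr fun k => ?_
      rw [inner_add_right]; ring)
    (fun c f g => by
      rw [smul_eq_mul, ← tsum_mul_left]
      refine tsum_congr fun k => ?_
      rw [inner_smul_right]; ring)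

lemma norm_weightedBilin_le {e : ℕ → E} (he : Orthonormal ℝ e) {w : ℕ → ℝ}
    (hw : ∀ k, |w k| ≤ 1) (f g : E) : ‖weightedBilin he hw f g‖ ≤ 1 * ‖f‖ * ‖g‖ := by
  rw [one_mul]
  exact abs_tsum_weighted_inner_le he hw f g

/-- `weightedBilin` as a continuous bilinear form. -/
noncomputable def weightedForm {e : ℕ → E} (he : Orthonormal ℝ e) {w : ℕ → ℝ}
    (hw : ∀ k, |w k| ≤ 1) : E →L[ℝ] E →L[ℝ] ℝ :=
  LinearMap.mkContinuous₂ (weightedBilin he hw) 1 (norm_weightedBilin_le he hw)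

lemma weightedForm_apply {e : ℕ → E} (he : Orthonormal ℝ e) {w : ℕ → ℝ}
    (hw : ∀ k, |w k| ≤ 1) (f g : E) :
    weightedForm he hw f g = ∑' k, w k * (inner ℝ (e k) f * inner ℝ (e k) g) := rfl

end WeightedForm

/-! ### Kibble's law and its Laguerre expansion. -/

/-- `ν` is Kibble's bivariate gamma distribution with correlation `ρ`. -/
structure IsKibbleLaw (α ρ : ℝ) (ν : Measure (ℝ × ℝ)) : Prop where
  isProbabilityMeasure : IsProbabilityMeasure ν
  nonneg : ∀ᵐ p ∂ν, 0 ≤ p.1 ∧ 0 ≤ p.2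
  laplace : ∀ s t : ℝ, 0 ≤ s → 0 ≤ t →
    ∫ p, Real.exp (-(s * p.1)) * Real.exp (-(t * p.2)) ∂ν =
      ((1 + s) * (1 + t) - ρ * (s * t)) ^ (-α)

lemma integral_exp_gammaMeasure {α s : ℝ} (hα : 0 < α) (hs : 0 ≤ s) :
    ∫ x, Real.exp (-(s * x)) ∂(gammaMeasure α 1) = (1 + s) ^ (-α) := by
  have h := integral_pow_mul_exp_gammaMeasure hα one_pos (s := s) (by linarith) 0
  simp only [pow_zero, one_mul, ascPochhammer_zero, Polynomial.eval_one, div_one,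
    Nat.cast_zero, add_zero] at h
  rw [h, one_div, Real.inv_rpow (by linarith), Real.rpow_neg (by linarith)]

lemma ae_nonneg_gammaMeasure (a r : ℝ) : ∀ᵐ x ∂(gammaMeasure a r), 0 ≤ x :=
  (ae_pos_gammaMeasure a r).mono fun _ h => h.le

/-- At `t = 0` the transform reduces to that of the gamma law. Both marginals being `γ`, composition
with a coordinate is an isometry from `L²(γ)` into `L²(ν)`. -/
lemma IsKibbleLaw.measurePreserving_fst {α ρ : ℝ} (hα : 0 < α) {ν : Measure (ℝ × ℝ)}
    (hν : IsKibbleLaw α ρ ν) : MeasurePreserving Prod.fst ν (gammaMeasure α 1) := by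
  have := hν.isProbabilityMeasure
  have := isProbabilityMeasure_gammaMeasure hα one_pos
  refine ⟨measurable_fst, ext_of_laplace_real ?_ (ae_nonneg_gammaMeasure α 1) ?_⟩
  · exact (ae_map_iff measurable_fst.aemeasurable measurableSet_Ici).2
      (hν.nonneg.mono fun p hp => hp.1)
  · intro s hs
    rw [integral_map (by fun_prop) (by fun_prop), integral_exp_gammaMeasure hα hs]
    simpa using hν.laplace s 0 hs le_rfl

lemma IsKibbleLaw.measurePreserving_snd {α ρ : ℝ} (hα : 0 < α) {ν : Measure (ℝ × ℝ)}
    (hν : IsKibbleLaw α ρ ν) : MeasurePreserving Prod.snd ν (gammaMeasure α 1) := by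
  have := hν.isProbabilityMeasure
  have := isProbabilityMeasure_gammaMeasure hα one_pos
  refine ⟨measurable_snd, ext_of_laplace_real ?_ (ae_nonneg_gammaMeasure α 1) ?_⟩
  · exact (ae_map_iff measurable_snd.aemeasurable measurableSet_Ici).2
      (hν.nonneg.mono fun p hp => hp.2)
  · intro s hs
    rw [integral_map (by fun_prop) (by fun_prop), integral_exp_gammaMeasure hα hs]
    simpa using hν.laplace 0 s le_rfl hs

/-- The bilinear form `(f, g) ↦ ∫ f(y₁) g(y₂) dν` of a coupling of two copies of `γ`. -/
noncomputable def couplingForm {γ : Measure ℝ} {ν : Measure (ℝ × ℝ)}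
    (h₁ : MeasurePreserving Prod.fst ν γ) (h₂ : MeasurePreserving Prod.snd ν γ) :
    Lp ℝ 2 γ →L[ℝ] Lp ℝ 2 γ →L[ℝ] ℝ :=
  (innerSL ℝ (E := Lp ℝ 2 ν)).bilinearComp
    (Lp.compMeasurePreservingₗᵢ ℝ Prod.fst h₁).toContinuousLinearMap
    (Lp.compMeasurePreservingₗᵢ ℝ Prod.snd h₂).toContinuousLinearMap

lemma couplingForm_apply {γ : Measure ℝ} {ν : Measure (ℝ × ℝ)}
    (h₁ : MeasurePreserving Prod.fst ν γ) (h₂ : MeasurePreserving Prod.snd ν γ)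
    {F G : Lp ℝ 2 γ} {f g : ℝ → ℝ} (hf : F =ᵐ[γ] f) (hg : G =ᵐ[γ] g) :
    couplingForm h₁ h₂ F G = ∫ p, f p.1 * g p.2 ∂ν := by
  change inner ℝ (Lp.compMeasurePreserving Prod.fst h₁ F)
    (Lp.compMeasurePreserving Prod.snd h₂ G) = _
  rw [L2.inner_def]
  refine integral_congr_ae ?_
  filter_upwards [Lp.coeFn_compMeasurePreserving F h₁, Lp.coeFn_compMeasurePreserving G h₂,
    h₁.quasiMeasurePreserving.ae_eq_comp hf, h₂.quasiMeasurePreserving.ae_eq_comp hg]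
    with p e1 e2 e3 e4
  simp only [Function.comp_apply] at e1 e2 e3 e4
  rw [e1, e2, e3, e4]
  simp [mul_comm]

lemma sqrt_inv_mul_mul {c a b : ℝ} (hc : 0 < c) :
    (Real.sqrt c)⁻¹ * a * ((Real.sqrt c)⁻¹ * b) = c⁻¹ * a * b := by
  have : (Real.sqrt c)⁻¹ * (Real.sqrt c)⁻¹ = c⁻¹ := by
    rw [← mul_inv, Real.mul_self_sqrt hc.le]
  linear_combination a * b * this

/-- By continuity and totality it suffices to compare two exponentials. There the Laguerre side is
Newton's series at `ρ s t / ((1 + s)(1 + t))`, and its sum is Kibble's transform. -/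
lemma IsKibbleLaw.weightedForm_eq {α ρ : ℝ} (hα : 0 < α) (hρ : |ρ| ≤ 1) {ν : Measure (ℝ × ℝ)}
    (hν : IsKibbleLaw α ρ ν) (hw : ∀ k, |ρ ^ k| ≤ 1) :
    weightedForm (orthonormal_laguerreLp hα) hw =
      couplingForm (hν.measurePreserving_fst hα) (hν.measurePreserving_snd hα) := by
  have := isProbabilityMeasure_gammaMeasure hα one_pos
  have hd := dense_span_expClasses (ae_nonneg_gammaMeasure α 1)
  refine ContinuousLinearMap.ext_on hd ?_
  rintro F ⟨s, hs, hF⟩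
  refine ContinuousLinearMap.ext_on hd ?_
  rintro G ⟨t, ht, hG⟩
  rw [couplingForm_apply _ _ hF hG, hν.laplace s t hs ht, weightedForm_apply]
  have hs1 : 0 < 1 + s := by linarith
  have ht1 : 0 < 1 + t := by linarith
  -- Strict even when `|ρ| = 1`, because `s / (1 + s) < 1`.
  have hz : |ρ * (s / (1 + s) * (t / (1 + t)))| < 1 := by
    rw [abs_mul, abs_of_nonneg (by positivity : 0 ≤ s / (1 + s) * (t / (1 + t)))]
    have h1 : s / (1 + s) < 1 := by rw [div_lt_one hs1]; linarith
    have h2 : t / (1 + t) < 1 := by rw [div_lt_one ht1]; linarith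
    have h3 : s / (1 + s) * (t / (1 + t)) < 1 :=
      mul_lt_one_of_nonneg_of_lt_one_left (by positivity) h1 h2.le
    exact (mul_le_of_le_one_left (by positivity) hρ).trans_lt h3
  have hsum := (hasSum_choose_mul_pow α hz).mul_left ((1 + s) ^ (-α) * (1 + t) ^ (-α))
  have hz' := (abs_lt.mp hz).2
  rw [← Real.mul_rpow hs1.le ht1.le, ← Real.mul_rpow (by positivity) (by linarith)] at hsum
  have hval : (1 + s) * (1 + t) * (1 - ρ * (s / (1 + s) * (t / (1 + t)))) =
      (1 + s) * (1 + t) - ρ * (s * t) := by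
    field_simp
  rw [hval] at hsum
  rw [← hsum.tsum_eq]
  refine tsum_congr fun k => ?_
  have hc := choose_pos hα k
  rw [inner_laguerreLp hα k hF, inner_laguerreLp hα k hG, sqrt_inv_mul_mul hc,
    integral_laguerre_mul_exp hα hs, integral_laguerre_mul_exp hα ht,
    Real.mul_rpow hs1.le ht1.le, mul_pow, mul_pow]
  field_simp

/-- The Laguerre (Mercer) expansion of Kibble's bivariate gamma distribution. -/
lemma IsKibbleLaw.hasSum_laguerre {α ρ : ℝ} (hα : 0 < α) (hρ : |ρ| ≤ 1) {ν : Measure (ℝ × ℝ)}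
    (hν : IsKibbleLaw α ρ ν) {f g : ℝ → ℝ} (hf : MemLp f 2 (gammaMeasure α 1))
    (hg : MemLp g 2 (gammaMeasure α 1)) :
    HasSum (fun k : ℕ => (Ring.choose (α + k - 1) k)⁻¹ * ρ ^ k *
        (∫ y, f y * laguerre (α - 1) k y ∂(gammaMeasure α 1)) *
        (∫ y, g y * laguerre (α - 1) k y ∂(gammaMeasure α 1)))
      (∫ p, f p.1 * g p.2 ∂ν) := by
  have hw : ∀ k, |ρ ^ k| ≤ 1 := fun k => by
    rw [abs_pow]; exact pow_le_one₀ (abs_nonneg _) hρ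
  have h1 := (summable_weighted_inner (orthonormal_laguerreLp hα) hw hf.toLp hg.toLp).hasSum
  rw [← weightedForm_apply (orthonormal_laguerreLp hα) hw, hν.weightedForm_eq hα hρ hw,
    couplingForm_apply _ _ hf.coeFn_toLp hg.coeFn_toLp] at h1
  convert h1 using 2 with k
  rw [inner_laguerreLp hα k hf.coeFn_toLp, inner_laguerreLp hα k hg.coeFn_toLp,
    sqrt_inv_mul_mul (choose_pos hα k)]
  simp_rw [mul_comm (laguerre _ _ _)]
  ring

/-! ### The `₀F₁` density and existence of Kibble's law. -/

/-- Every factor of `(α)ₖ` after the first exceeds `1`. This crude bound compares `₀F₁` with the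
exponential series. -/
lemma min_one_le_ascPochhammer_eval {α : ℝ} (hα : 0 < α) (k : ℕ) :
    min α 1 ≤ (ascPochhammer ℝ k).eval α := by
  induction k with
  | zero => simp
  | succ k ih =>
    rw [ascPochhammer_eval_succ]
    rcases k with _ | k
    · simp
    · have h1 : (1 : ℝ) ≤ α + (k + 1 : ℕ) := by push_cast; linarith [(Nat.cast_nonneg k : (0:ℝ) ≤ k)]
      exact ih.trans (le_mul_of_one_le_right (ascPochhammer_pos _ α hα).le h1)

lemma summable_hyp0F1 {α : ℝ} (hα : 0 < α) (z : ℝ) :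
    Summable fun k : ℕ => z ^ k / ((ascPochhammer ℝ k).eval α * (k.factorial : ℝ)) := by
  have hm : 0 < min α 1 := by positivity
  refine Summable.of_norm_bounded
    ((Real.summable_pow_div_factorial |z|).mul_left (min α 1)⁻¹) fun k => ?_
  have hp := ascPochhammer_pos k α hα
  rw [Real.norm_eq_abs, abs_div, abs_pow, abs_of_pos (by positivity : 0 < _ * (k.factorial : ℝ)),
    inv_mul_eq_div, div_div, mul_comm (k.factorial : ℝ)]
  gcongr
  exact min_one_le_ascPochhammer_eval hα k

lemma hyp0F1_term_nonneg {α z : ℝ} (hα : 0 < α) (hz : 0 ≤ z) (k : ℕ) :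
    0 ≤ z ^ k / ((ascPochhammer ℝ k).eval α * (k.factorial : ℝ)) := by
  have hp := ascPochhammer_pos k α hα
  positivity

lemma hyp0F1_nonneg {α z : ℝ} (hα : 0 < α) (hz : 0 ≤ z) : 0 ≤ hyp0F1 α z :=
  tsum_nonneg (hyp0F1_term_nonneg hα hz)

lemma ofReal_hyp0F1 {α z : ℝ} (hα : 0 < α) (hz : 0 ≤ z) :
    ENNReal.ofReal (hyp0F1 α z) = ∑' k : ℕ,
      ENNReal.ofReal (z ^ k / ((ascPochhammer ℝ k).eval α * (k.factorial : ℝ))) :=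
  ENNReal.ofReal_tsum_of_nonneg (hyp0F1_term_nonneg hα hz) (summable_hyp0F1 hα z)

lemma measurable_hyp0F1 {α : ℝ} (hα : 0 < α) : Measurable (hyp0F1 α) := by
  refine measurable_of_tendsto_metrizable (f := fun n z => ∑ k ∈ Finset.range n,
    z ^ k / ((ascPochhammer ℝ k).eval α * (k.factorial : ℝ))) (fun n => by fun_prop) ?_
  rw [tendsto_pi_nhds]
  exact fun z => (summable_hyp0F1 hα z).hasSum.tendsto_sum_nat

/-- The density of the scaled Kibble distribution with respect to `γ ⊗ γ`. -/
noncomputable def kibbleDensity (α ρ : ℝ) (p : ℝ × ℝ) : ℝ :=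
  (1 - ρ) ^ α * hyp0F1 α (ρ * p.1 * p.2)

lemma measurable_kibbleDensity {α : ℝ} (hα : 0 < α) (ρ : ℝ) :
    Measurable (kibbleDensity α ρ) :=
  ((measurable_hyp0F1 hα).comp (by fun_prop)).const_mul _

lemma ae_pos_prod_gammaMeasure {α : ℝ} (hα : 0 < α) :
    ∀ᵐ p ∂((gammaMeasure α 1).prod (gammaMeasure α 1)), 0 < p.1 ∧ 0 < p.2 := by
  have := isProbabilityMeasure_gammaMeasure hα one_pos
  have h1 := Measure.quasiMeasurePreserving_fst (μ := gammaMeasure α 1) (ν := gammaMeasure α 1)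
    |>.ae (ae_pos_gammaMeasure α 1)
  have h2 := Measure.quasiMeasurePreserving_snd (μ := gammaMeasure α 1) (ν := gammaMeasure α 1)
    |>.ae (ae_pos_gammaMeasure α 1)
  filter_upwards [h1, h2] with p hp hq using ⟨hp, hq⟩

/-- By Tonelli each term of `₀F₁` contributes a product of two tilted moments. One factor `(α)ₖ`
cancels, and the remaining `(α)ₖ / k!` is the coefficient of Newton's series at `ρ / ((1 + s)(1 +
t))`. -/
lemma lintegral_exp_mul_kibbleDensity {α ρ s t : ℝ} (hα : 0 < α) (hρ : 0 ≤ ρ) (hρ1 : ρ < 1)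
    (hs : 0 ≤ s) (ht : 0 ≤ t) :
    ∫⁻ p, ENNReal.ofReal (kibbleDensity α ρ p) *
      (ENNReal.ofReal (Real.exp (-(s * p.1))) * ENNReal.ofReal (Real.exp (-(t * p.2))))
        ∂((gammaMeasure α 1).prod (gammaMeasure α 1)) =
      ENNReal.ofReal ((1 - ρ) ^ α * ((1 + s) * (1 + t) - ρ) ^ (-α)) := by
  have := isProbabilityMeasure_gammaMeasure hα one_pos
  have hs1 : 0 < 1 + s := by linarith
  have ht1 : 0 < 1 + t := by linarith
  have hr : 0 < 1 - ρ := by linarith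
  let w : ℕ → ℝ := fun k =>
    (1 - ρ) ^ α * (ρ ^ k / ((ascPochhammer ℝ k).eval α * (k.factorial : ℝ)))
  have hw : ∀ k, 0 ≤ w k := fun k =>
    mul_nonneg (by positivity) (hyp0F1_term_nonneg hα hρ k)
  calc _ = ∫⁻ p, ∑' k : ℕ, ENNReal.ofReal (w k) *
        ((ENNReal.ofReal (p.1 ^ k) * ENNReal.ofReal (Real.exp (-(s * p.1)))) *
        (ENNReal.ofReal (p.2 ^ k) * ENNReal.ofReal (Real.exp (-(t * p.2)))))
        ∂((gammaMeasure α 1).prod (gammaMeasure α 1)) := by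
        refine lintegral_congr_ae ?_
        filter_upwards [ae_pos_prod_gammaMeasure hα] with p hp
        obtain ⟨h1, h2⟩ := hp
        rw [kibbleDensity, ENNReal.ofReal_mul (by positivity), ofReal_hyp0F1 hα (by positivity),
          ← ENNReal.tsum_mul_left, ← ENNReal.tsum_mul_right]
        refine tsum_congr fun k => ?_
        have hp := ascPochhammer_pos k α hα
        rw [mul_pow, mul_pow, show ρ ^ k * p.1 ^ k * p.2 ^ k /
          ((ascPochhammer ℝ k).eval α * (k.factorial : ℝ)) =
          ρ ^ k / ((ascPochhammer ℝ k).eval α * (k.factorial : ℝ)) * (p.1 ^ k * p.2 ^ k) by ring,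
          ENNReal.ofReal_mul (hyp0F1_term_nonneg hα hρ k), ENNReal.ofReal_mul (by positivity),
          ENNReal.ofReal_mul (by positivity : 0 ≤ (1 - ρ) ^ α)]
        ring
    _ = ∑' k : ℕ, ENNReal.ofReal (w k *
          (((ascPochhammer ℝ k).eval α / 1 ^ k * (1 / (1 + s)) ^ (α + k)) *
          ((ascPochhammer ℝ k).eval α / 1 ^ k * (1 / (1 + t)) ^ (α + k)))) := by
        rw [lintegral_tsum (fun k => by fun_prop)]
        refine tsum_congr fun k => ?_
        have hp := ascPochhammer_pos k α hα
        rw [lintegral_const_mul _ (by fun_prop),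
          lintegral_prod_mul (μ := gammaMeasure α 1) (ν := gammaMeasure α 1)
          (f := fun x => ENNReal.ofReal (x ^ k) * ENNReal.ofReal (Real.exp (-(s * x))))
          (g := fun x => ENNReal.ofReal (x ^ k) * ENNReal.ofReal (Real.exp (-(t * x))))
          (by fun_prop) (by fun_prop),
          lintegral_pow_mul_exp_gammaMeasure hα one_pos hs1,
          lintegral_pow_mul_exp_gammaMeasure hα one_pos ht1,
          ← ENNReal.ofReal_mul (by positivity), ← ENNReal.ofReal_mul (hw k)]
    _ = _ := by
        have hst : 1 ≤ (1 + s) * (1 + t) := by nlinarith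
        have hz : |ρ / ((1 + s) * (1 + t))| < 1 := by
          rw [abs_of_nonneg (by positivity), div_lt_one (by positivity)]
          linarith
        have hsum := (hasSum_choose_mul_pow α hz).mul_left
          ((1 - ρ) ^ α * ((1 + s) * (1 + t)) ^ (-α))
        have hpos : 0 ≤ 1 - ρ / ((1 + s) * (1 + t)) := by
          linarith [(abs_lt.mp hz).2]
        rw [mul_assoc, ← Real.mul_rpow (by positivity) hpos,
          show (1 + s) * (1 + t) * (1 - ρ / ((1 + s) * (1 + t))) = (1 + s) * (1 + t) - ρ by
            field_simp] at hsum
        rw [← hsum.tsum_eq, ENNReal.ofReal_tsum_of_nonneg _ hsum.summable]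
        · refine tsum_congr fun k => ?_
          congr 1
          have hp := ascPochhammer_pos k α hα
          simp only [w]
          rw [Real.rpow_add (by positivity), Real.rpow_add (by positivity), Real.rpow_natCast,
            Real.rpow_natCast, Real.div_rpow zero_le_one hs1.le, Real.div_rpow zero_le_one ht1.le,
            Real.one_rpow, Real.rpow_neg (by positivity), Real.mul_rpow hs1.le ht1.le,
            choose_eq_ascPochhammer_div, div_pow, div_pow, div_pow, one_pow, mul_pow]
          field_simp
        · intro k
          have hc := choose_pos hα k
          positivity

/-- Kibble's bivariate gamma distribution with correlation `ρ < 1`. -/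
noncomputable def kibbleMeasure (α ρ : ℝ) : Measure (ℝ × ℝ) :=
  (((gammaMeasure α 1).prod (gammaMeasure α 1)).withDensity
    fun p => ENNReal.ofReal (kibbleDensity α ρ p)).map
      fun p => ((1 - ρ) * p.1, (1 - ρ) * p.2)

lemma lintegral_kibbleMeasure {α : ℝ} (hα : 0 < α) (ρ : ℝ) {f : ℝ × ℝ → ENNReal}
    (hf : Measurable f) :
    ∫⁻ p, f p ∂(kibbleMeasure α ρ) = ∫⁻ p, ENNReal.ofReal (kibbleDensity α ρ p) *
      f ((1 - ρ) * p.1, (1 - ρ) * p.2) ∂((gammaMeasure α 1).prod (gammaMeasure α 1)) := by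
  rw [kibbleMeasure, lintegral_map hf (by fun_prop), lintegral_withDensity_eq_lintegral_mul _
    (measurable_kibbleDensity hα ρ).ennreal_ofReal (by fun_prop)]
  rfl

lemma lintegral_exp_kibbleMeasure {α ρ s t : ℝ} (hα : 0 < α) (hρ : 0 ≤ ρ) (hρ1 : ρ < 1)
    (hs : 0 ≤ s) (ht : 0 ≤ t) :
    ∫⁻ p, ENNReal.ofReal (Real.exp (-(s * p.1)) * Real.exp (-(t * p.2))) ∂(kibbleMeasure α ρ) =
      ENNReal.ofReal (((1 + s) * (1 + t) - ρ * (s * t)) ^ (-α)) := by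
  have hr : 0 < 1 - ρ := by linarith
  have h := lintegral_exp_mul_kibbleDensity hα hρ hρ1
    (mul_nonneg hs hr.le) (mul_nonneg ht hr.le)
  rw [lintegral_kibbleMeasure hα ρ (by fun_prop)]
  simp_rw [ENNReal.ofReal_mul (Real.exp_nonneg _), ← mul_assoc s, ← mul_assoc t]
  rw [h]
  congr 1
  have hst : 0 ≤ (s + t) + s * t * (1 - ρ) := by positivity
  -- This identity dictates the scaling by `1 - ρ`: the factor it releases cancels the normalization
  -- `(1 - ρ) ^ α`.
  have e1 : (1 + s * (1 - ρ)) * (1 + t * (1 - ρ)) - ρ =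
      (1 - ρ) * ((1 + s) * (1 + t) - ρ * (s * t)) := by ring
  rw [e1, Real.mul_rpow hr.le (by nlinarith), ← mul_assoc, ← Real.rpow_add hr]
  simp

lemma isKibbleLaw_kibbleMeasure {α ρ : ℝ} (hα : 0 < α) (hρ : 0 ≤ ρ) (hρ1 : ρ < 1) :
    IsKibbleLaw α ρ (kibbleMeasure α ρ) where
  isProbabilityMeasure := ⟨by
    have := lintegral_exp_kibbleMeasure hα hρ hρ1 le_rfl le_rfl
    simpa using this⟩
  nonneg := by
    have hr : 0 < 1 - ρ := by linarith
    refine (ae_map_iff (by fun_prop)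
      (measurableSet_Ici.preimage measurable_fst |>.inter
        (measurableSet_Ici.preimage measurable_snd))).2 ?_
    refine (withDensity_absolutelyContinuous _ _).ae_le ?_
    filter_upwards [ae_pos_prod_gammaMeasure hα] with p hp
    exact ⟨mul_nonneg hr.le hp.1.le, mul_nonneg hr.le hp.2.le⟩
  laplace s t hs ht := by
    have hst : 0 ≤ (1 + s) * (1 + t) - ρ * (s * t) := by nlinarith [mul_nonneg hs ht]
    rw [integral_eq_lintegral_of_nonneg_ae (ae_of_all _ fun p => by positivity) (by fun_prop),
      lintegral_exp_kibbleMeasure hα hρ hρ1 hs ht, ENNReal.toReal_ofReal (by positivity)]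

/-- At `ρ = 1` the transform collapses to `(1 + s + t) ^ (-α)`: the two coordinates coincide. -/
lemma isKibbleLaw_diagonal {α : ℝ} (hα : 0 < α) :
    IsKibbleLaw α 1 ((gammaMeasure α 1).map fun x => (x, x)) where
  isProbabilityMeasure := by
    have := isProbabilityMeasure_gammaMeasure hα one_pos
    exact Measure.isProbabilityMeasure_map (by fun_prop)
  nonneg := by
    refine (ae_map_iff (by fun_prop)
      (measurableSet_Ici.preimage measurable_fst |>.inter
        (measurableSet_Ici.preimage measurable_snd))).2 ?_
    filter_upwards [ae_pos_gammaMeasure α 1] with x hx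
    exact ⟨hx.le, hx.le⟩
  laplace s t hs ht := by
    rw [integral_map (by fun_prop) (by fun_prop)]
    simp_rw [← Real.exp_add]
    have h := integral_exp_gammaMeasure hα (add_nonneg hs ht)
    rw [show (1 + s) * (1 + t) - 1 * (s * t) = 1 + (s + t) by ring, ← h]
    refine integral_congr_ae (ae_of_all _ fun x => ?_)
    simp only
    congr 1
    ring

lemma exists_isKibbleLaw {α ρ : ℝ} (hα : 0 < α) (hρ : 0 ≤ ρ) (hρ1 : ρ ≤ 1) :
    ∃ ν, IsKibbleLaw α ρ ν := by
  rcases hρ1.lt_or_eq with h | rfl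
  · exact ⟨_, isKibbleLaw_kibbleMeasure hα hρ h⟩
  · exact ⟨_, isKibbleLaw_diagonal hα⟩

/-! ### Integrals against `γ ⊗ γ` and Kibble's law as integrals over the open quadrant. -/

lemma prod_gammaMeasure (α : ℝ) :
    (gammaMeasure α 1).prod (gammaMeasure α 1) =
      (volume : Measure (ℝ × ℝ)).withDensity fun p => gammaPDF α 1 p.1 * gammaPDF α 1 p.2 := by
  rw [gammaMeasure, prod_withDensity (measurable_gammaPDF α 1) (measurable_gammaPDF α 1)]
  rfl

lemma gammaPDFReal_prod_mul_eq_indicator (α : ℝ) (f : ℝ × ℝ → ℝ) :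
    (fun p => (gammaPDFReal α 1 p.1 * gammaPDFReal α 1 p.2) * f p) =ᵐ[volume]
      (Ioi (0 : ℝ) ×ˢ Ioi (0 : ℝ)).indicator (fun p => f p * gPdf α p.1 * gPdf α p.2) := by
  have h1 := Measure.quasiMeasurePreserving_fst (μ := (volume : Measure ℝ))
    (ν := (volume : Measure ℝ)) |>.ae (Measure.ae_ne volume (0 : ℝ))
  have h2 := Measure.quasiMeasurePreserving_snd (μ := (volume : Measure ℝ))
    (ν := (volume : Measure ℝ)) |>.ae (Measure.ae_ne volume (0 : ℝ))
  filter_upwards [h1, h2] with p hp hq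
  by_cases h : p ∈ Ioi (0 : ℝ) ×ˢ Ioi (0 : ℝ)
  · rw [indicator_of_mem h]
    simp only [gPdf]
    ring
  · rw [indicator_of_notMem h]
    rw [mem_prod, not_and_or] at h
    rcases h with h | h
    · have : ¬ 0 ≤ p.1 := fun h' => h (lt_of_le_of_ne h' (Ne.symm hp))
      simp [gammaPDFReal, this]
    · have : ¬ 0 ≤ p.2 := fun h' => h (lt_of_le_of_ne h' (Ne.symm hq))
      simp [gammaPDFReal, this]

lemma gammaPDF_mul_lt_top (α : ℝ) (p : ℝ × ℝ) : gammaPDF α 1 p.1 * gammaPDF α 1 p.2 < ⊤ :=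
  ENNReal.mul_lt_top ENNReal.ofReal_lt_top ENNReal.ofReal_lt_top

lemma toReal_gammaPDF_mul {α : ℝ} (hα : 0 < α) (p : ℝ × ℝ) :
    (gammaPDF α 1 p.1 * gammaPDF α 1 p.2).toReal =
      gammaPDFReal α 1 p.1 * gammaPDFReal α 1 p.2 := by
  rw [ENNReal.toReal_mul, gammaPDF, gammaPDF,
    ENNReal.toReal_ofReal (gammaPDFReal_nonneg hα one_pos _),
    ENNReal.toReal_ofReal (gammaPDFReal_nonneg hα one_pos _)]

lemma integral_prod_gammaMeasure {α : ℝ} (hα : 0 < α) (f : ℝ × ℝ → ℝ) :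
    ∫ p, f p ∂((gammaMeasure α 1).prod (gammaMeasure α 1)) =
      ∫ p in Ioi (0 : ℝ) ×ˢ Ioi (0 : ℝ), f p * gPdf α p.1 * gPdf α p.2 := by
  rw [prod_gammaMeasure, integral_withDensity_eq_integral_toReal_smul (by fun_prop)
    (ae_of_all _ (gammaPDF_mul_lt_top α))]
  simp_rw [toReal_gammaPDF_mul hα, smul_eq_mul]
  rw [integral_congr_ae (gammaPDFReal_prod_mul_eq_indicator α f),
    integral_indicator (measurableSet_Ioi.prod measurableSet_Ioi)]

lemma integrable_prod_gammaMeasure_iff {α : ℝ} (hα : 0 < α) (f : ℝ × ℝ → ℝ) :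
    Integrable f ((gammaMeasure α 1).prod (gammaMeasure α 1)) ↔
      IntegrableOn (fun p => f p * gPdf α p.1 * gPdf α p.2) (Ioi (0 : ℝ) ×ˢ Ioi (0 : ℝ)) := by
  rw [prod_gammaMeasure, integrable_withDensity_iff_integrable_smul₀' (by fun_prop)
    (ae_of_all _ (gammaPDF_mul_lt_top α))]
  simp_rw [toReal_gammaPDF_mul hα, smul_eq_mul]
  rw [integrable_congr (gammaPDFReal_prod_mul_eq_indicator α f),
    integrable_indicator_iff (measurableSet_Ioi.prod measurableSet_Ioi)]

lemma ae_kibbleDensity_nonneg {α ρ : ℝ} (hα : 0 < α) (hρ : 0 ≤ ρ) (hρ1 : ρ < 1) :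
    ∀ᵐ p ∂((gammaMeasure α 1).prod (gammaMeasure α 1)), 0 ≤ kibbleDensity α ρ p := by
  filter_upwards [ae_pos_prod_gammaMeasure hα] with p hp
  obtain ⟨h1, h2⟩ := hp
  have hr : 0 < 1 - ρ := by linarith
  exact mul_nonneg (by positivity) (hyp0F1_nonneg hα (by positivity))

lemma integrable_kibbleMeasure {α ρ : ℝ} (hα : 0 < α) (hρ : 0 ≤ ρ) (hρ1 : ρ < 1)
    {f : ℝ × ℝ → ℝ} (hf : Integrable f (kibbleMeasure α ρ)) :
    Integrable (fun p => kibbleDensity α ρ p * f ((1 - ρ) * p.1, (1 - ρ) * p.2))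
      ((gammaMeasure α 1).prod (gammaMeasure α 1)) := by
  have h1 := (integrable_map_measure (f := fun p : ℝ × ℝ => ((1 - ρ) * p.1, (1 - ρ) * p.2))
    hf.aestronglyMeasurable (by fun_prop)).1 hf
  rw [integrable_withDensity_iff_integrable_smul₀'
    (measurable_kibbleDensity hα ρ).ennreal_ofReal.aemeasurable
    (ae_of_all _ fun p => ENNReal.ofReal_lt_top)] at h1
  refine h1.congr ?_
  filter_upwards [ae_kibbleDensity_nonneg hα hρ hρ1] with p hp
  simp [ENNReal.toReal_ofReal hp]

lemma integral_kibbleMeasure {α ρ : ℝ} (hα : 0 < α) (hρ : 0 ≤ ρ) (hρ1 : ρ < 1)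
    {f : ℝ × ℝ → ℝ} (hf : AEStronglyMeasurable f (kibbleMeasure α ρ)) :
    ∫ p, f p ∂(kibbleMeasure α ρ) =
      ∫ p, kibbleDensity α ρ p * f ((1 - ρ) * p.1, (1 - ρ) * p.2)
        ∂((gammaMeasure α 1).prod (gammaMeasure α 1)) := by
  rw [kibbleMeasure] at hf ⊢
  rw [integral_map (by fun_prop) hf, integral_withDensity_eq_integral_toReal_smul
    (measurable_kibbleDensity hα ρ).ennreal_ofReal (ae_of_all _ fun p => ENNReal.ofReal_lt_top)]
  refine integral_congr_ae ?_
  filter_upwards [ae_kibbleDensity_nonneg hα hρ hρ1] with p hp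
  simp [ENNReal.toReal_ofReal hp]

/-! ### Non-central gamma distributions. -/

/-- The density of the non-central gamma distribution with rate `r` and non-centrality `l * y`,
relative to the central gamma distribution with rate `r`. -/
noncomputable def ncDensity (α r l y x : ℝ) : ENNReal :=
  ∑' m : ℕ, ENNReal.ofReal (Real.exp (-(l * y)) * ((l * y) ^ m / (m.factorial : ℝ))) *
    (ENNReal.ofReal (r ^ m / (ascPochhammer ℝ m).eval α) * ENNReal.ofReal (x ^ m))

@[fun_prop]
lemma Measurable.ncDensity {X : Type*} [MeasurableSpace X] {f g : X → ℝ} (α r l : ℝ)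
    (hf : Measurable f) (hg : Measurable g) :
    Measurable fun p => MultivariateGamma.ncDensity α r l (f p) (g p) :=
  Measurable.tsum fun m => by fun_prop

/-- The non-central law is a Poisson mixture of gamma laws of shape `α + m`; the factor `r ^ m x ^ m
/ (α)ₘ` is exactly the density of shape `α + m` relative to shape `α`. -/
lemma lintegral_ncDensity_mul {α r : ℝ} (hα : 0 < α) (hr : 0 < r) (l y : ℝ) {f : ℝ → ENNReal}
    (hf : Measurable f) :
    ∫⁻ x, ncDensity α r l y x * f x ∂(gammaMeasure α r) =
      ∑' m : ℕ, ENNReal.ofReal (Real.exp (-(l * y)) * ((l * y) ^ m / (m.factorial : ℝ))) *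
        ∫⁻ x, f x ∂(gammaMeasure (α + m) r) := by
  simp_rw [ncDensity, ← ENNReal.tsum_mul_right, mul_assoc]
  rw [lintegral_tsum fun m => by fun_prop]
  refine tsum_congr fun m => ?_
  have hp := ascPochhammer_pos m α hα
  rw [lintegral_const_mul _ (by fun_prop), lintegral_const_mul _ (by fun_prop),
    lintegral_pow_mul_gammaMeasure hα hr m hf, ← mul_assoc (ENNReal.ofReal (_ / _)),
    ← ENNReal.ofReal_mul (by positivity)]
  rw [show r ^ m / (ascPochhammer ℝ m).eval α * ((ascPochhammer ℝ m).eval α / r ^ m) = 1 by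
    field_simp, ENNReal.ofReal_one, one_mul]

/-- With `q = r / (r + t)`, shape `α + m` contributes `q ^ (α + m)`; the Poisson generating function
gives `exp (-l y (1 - q))`, where `1 - q = t / (r + t)`. -/
lemma lintegral_ncDensity_mul_exp {α r l y t : ℝ} (hα : 0 < α) (hr : 0 < r) (hly : 0 ≤ l * y)
    (ht : 0 ≤ t) :
    ∫⁻ x, ncDensity α r l y x * ENNReal.ofReal (Real.exp (-(t * x))) ∂(gammaMeasure α r) =
      ENNReal.ofReal ((r / (r + t)) ^ α * Real.exp (-(l * t / (r + t) * y))) := by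
  have hrt : 0 < r + t := by linarith
  have hq : 0 < r / (r + t) := by positivity
  rw [lintegral_ncDensity_mul hα hr l y (by fun_prop)]
  have hexp := (NormedSpace.expSeries_div_hasSum_exp (𝔸 := ℝ) (l * y * (r / (r + t)))).mul_left
    ((r / (r + t)) ^ α * Real.exp (-(l * y)))
  rw [← Real.exp_eq_exp_ℝ, mul_assoc ((r / (r + t)) ^ α), ← Real.exp_add,
    show -(l * y) + l * y * (r / (r + t)) = -(l * t / (r + t) * y) by field_simp; ring] at hexp
  rw [← hexp.tsum_eq, ENNReal.ofReal_tsum_of_nonneg (fun n => by positivity) hexp.summable]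
  refine tsum_congr fun m => ?_
  rw [lintegral_exp_gammaMeasure (by positivity) hr hrt, ← ENNReal.ofReal_mul (by positivity),
    Real.rpow_add hq, Real.rpow_natCast, mul_pow]
  congr 1
  ring

lemma gCdf_nonneg (a x : ℝ) : 0 ≤ gCdf a x := cdf_nonneg _ _

lemma gCdf_le_one (a x : ℝ) : gCdf a x ≤ 1 := cdf_le_one _ _

lemma summable_ncCdf (α x y : ℝ) :
    Summable fun n : ℕ => gCdf (α + n) x * (y ^ n / (n.factorial : ℝ)) := by
  refine Summable.of_norm_bounded (Real.summable_pow_div_factorial |y|) fun n => ?_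
  rw [norm_mul, Real.norm_of_nonneg (gCdf_nonneg _ _), norm_div, norm_pow, Real.norm_eq_abs,
    Real.norm_of_nonneg (by positivity : (0 : ℝ) ≤ (n.factorial : ℝ))]
  exact mul_le_of_le_one_left (by positivity) (gCdf_le_one _ _)

lemma ncCdf_nonneg (α x : ℝ) {y : ℝ} (hy : 0 ≤ y) : 0 ≤ ncCdf α x y :=
  mul_nonneg (Real.exp_nonneg _)
    (tsum_nonneg fun n => mul_nonneg (gCdf_nonneg _ _) (by positivity))

lemma ncCdf_le_one (α x : ℝ) {y : ℝ} (hy : 0 ≤ y) : ncCdf α x y ≤ 1 := by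
  have h : ∑' n : ℕ, gCdf (α + n) x * (y ^ n / (n.factorial : ℝ)) ≤ Real.exp y := by
    rw [Real.exp_eq_exp_ℝ, NormedSpace.exp_eq_tsum_div]
    exact (summable_ncCdf α x y).tsum_le_tsum
      (fun n => mul_le_of_le_one_left (by positivity) (gCdf_le_one _ _))
      (Real.summable_pow_div_factorial y)
  calc ncCdf α x y ≤ Real.exp (-y) * Real.exp y := by
        unfold ncCdf
        gcongr
    _ = 1 := by rw [← Real.exp_add]; simp

lemma measurable_ncCdf (α x : ℝ) : Measurable (ncCdf α x) := by
  refine (Real.measurable_exp.comp measurable_neg).mul ?_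
  refine measurable_of_tendsto_metrizable (f := fun n y => ∑ k ∈ Finset.range n,
    gCdf (α + k) x * (y ^ k / (k.factorial : ℝ))) (fun n => by fun_prop) ?_
  rw [tendsto_pi_nhds]
  exact fun y => (summable_ncCdf α x y).hasSum.tendsto_sum_nat

lemma lintegral_ncDensity_mul_indicator_Iic {α r l y : ℝ} (hα : 0 < α) (hr : 0 < r)
    (hly : 0 ≤ l * y) (x : ℝ) :
    ∫⁻ z, ncDensity α r l y z * (Iic x).indicator 1 z ∂(gammaMeasure α r) =
      ENNReal.ofReal (ncCdf α (r * x) (l * y)) := by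
  rw [lintegral_ncDensity_mul hα hr l y (measurable_one.indicator measurableSet_Iic), ncCdf,
    ← tsum_mul_left, ENNReal.ofReal_tsum_of_nonneg _ ((summable_ncCdf α _ _).mul_left _)]
  · refine tsum_congr fun m => ?_
    rw [lintegral_indicator_one measurableSet_Iic, gammaMeasure_Iic (by positivity) hr,
      ← ENNReal.ofReal_mul (by positivity)]
    congr 1
    ring
  · intro n
    exact mul_nonneg (Real.exp_nonneg _) (mul_nonneg (gCdf_nonneg _ _) (by positivity))

lemma measurable_blockProd {m : ℕ} (α : ℝ) (a x : Fin m → ℝ) : Measurable (blockProd α a x) := by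
  unfold blockProd
  exact Finset.measurable_prod _ fun j _ => (measurable_ncCdf _ _).comp (by fun_prop)

lemma one_sub_sq_pos {a : ℝ} (ha : a ∈ Ioo (-1 : ℝ) 1) : 0 < 1 - a ^ 2 := by
  nlinarith [ha.1, ha.2]

lemma blockProd_nonneg {m : ℕ} (α : ℝ) {a : Fin m → ℝ} (ha : ∀ j, a j ∈ Ioo (-1 : ℝ) 1)
    (x : Fin m → ℝ) {y : ℝ} (hy : 0 ≤ y) : 0 ≤ blockProd α a x y :=
  Finset.prod_nonneg fun j _ => ncCdf_nonneg _ _ (by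
    have := one_sub_sq_pos (ha j)
    positivity)

lemma blockProd_le_one {m : ℕ} (α : ℝ) {a : Fin m → ℝ} (ha : ∀ j, a j ∈ Ioo (-1 : ℝ) 1)
    (x : Fin m → ℝ) {y : ℝ} (hy : 0 ≤ y) : blockProd α a x y ≤ 1 := by
  have h : ∀ j, 0 ≤ (1 - a j ^ 2)⁻¹ * a j ^ 2 * y := fun j => by
    have := one_sub_sq_pos (ha j)
    positivity
  exact Finset.prod_le_one (fun j _ => ncCdf_nonneg _ _ (h j)) fun j _ => ncCdf_le_one _ _ (h j)

lemma norm_blockProd_le_one {m : ℕ} (α : ℝ) {a : Fin m → ℝ} (ha : ∀ j, a j ∈ Ioo (-1 : ℝ) 1)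
    (x : Fin m → ℝ) {y : ℝ} (hy : 0 ≤ y) : ‖blockProd α a x y‖ ≤ 1 := by
  rw [Real.norm_of_nonneg (blockProd_nonneg α ha x hy)]
  exact blockProd_le_one α ha x hy

/-! ### Mixtures of independent non-central gamma vectors. -/

section Mixture

variable {ι : Type*} [Fintype ι]

/-- The law of a vector whose components are, given a `ν`-distributed parameter `p`, independent
non-central gamma variables with rates `r j` and non-centralities `l j * c j p`. -/
noncomputable def gammaMixture (α : ℝ) (r l : ι → ℝ) (c : ι → ℝ × ℝ → ℝ) (ν : Measure (ℝ × ℝ)) :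
    Measure (ι → ℝ) :=
  ((ν.prod (Measure.pi fun j => gammaMeasure α (r j))).withDensity fun q =>
    ∏ j, ncDensity α (r j) (l j) (c j q.1) (q.2 j)).map Prod.snd

lemma lintegral_pi_prod {κ : ι → Measure ℝ} [∀ j, IsProbabilityMeasure (κ j)]
    {f : ι → ℝ → ENNReal} (hf : ∀ j, Measurable (f j)) :
    ∫⁻ x, ∏ j, f j (x j) ∂(Measure.pi κ) = ∏ j, ∫⁻ x, f j x ∂(κ j) := by
  rw [lintegral_prod_eq_prod_lintegral_of_indepFun Finset.univ (fun j (x : ι → ℝ) => f j (x j))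
    (iIndepFun_pi fun j => (hf j).aemeasurable) (fun j => (hf j).comp (measurable_pi_apply j))]
  refine Finset.prod_congr rfl fun j _ => ?_
  rw [← lintegral_map (hf j) (measurable_pi_apply j)]
  congr 1
  exact (measurePreserving_eval κ j).map_eq

/-- Product test functions suffice: the Laplace kernel and the indicator of a lower orthant both
factor over coordinates. Conditional independence then factors the inner integral. -/
lemma lintegral_gammaMixture {α : ℝ} (hα : 0 < α) {r l : ι → ℝ} (hr : ∀ j, 0 < r j)
    {c : ι → ℝ × ℝ → ℝ} (hc : ∀ j, Measurable (c j)) {ν : Measure (ℝ × ℝ)} [SFinite ν]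
    {f : ι → ℝ → ENNReal} (hf : ∀ j, Measurable (f j)) :
    ∫⁻ x, ∏ j, f j (x j) ∂(gammaMixture α r l c ν) =
      ∫⁻ p, ∏ j, ∫⁻ x, ncDensity α (r j) (l j) (c j p) x * f j x ∂(gammaMeasure α (r j)) ∂ν := by
  have : ∀ j, IsProbabilityMeasure (gammaMeasure α (r j)) :=
    fun j => isProbabilityMeasure_gammaMeasure hα (hr j)
  have hF : Measurable fun x : ι → ℝ => ∏ j, f j (x j) :=
    Finset.measurable_prod _ fun j _ => (hf j).comp (measurable_pi_apply j)
  have hD : Measurable fun q : (ℝ × ℝ) × (ι → ℝ) =>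
      ∏ j, ncDensity α (r j) (l j) (c j q.1) (q.2 j) :=
    Finset.measurable_prod _ fun j _ => by fun_prop
  have hF' : Measurable fun q : (ℝ × ℝ) × (ι → ℝ) => ∏ j, f j (q.2 j) := hF.comp measurable_snd
  rw [gammaMixture, lintegral_map hF measurable_snd,
    lintegral_withDensity_eq_lintegral_mul _ hD hF', lintegral_prod _ (hD.mul hF').aemeasurable]
  refine lintegral_congr fun p => ?_
  simp only [Pi.mul_apply, ← Finset.prod_mul_distrib]
  exact lintegral_pi_prod (f := fun j x => ncDensity α (r j) (l j) (c j p) x * f j x)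
    fun j => by fun_prop

lemma ae_nonneg_gammaMixture {α : ℝ} (hα : 0 < α) {r : ι → ℝ} (hr : ∀ j, 0 < r j) (l : ι → ℝ)
    (c : ι → ℝ × ℝ → ℝ) (ν : Measure (ℝ × ℝ)) [SFinite ν] :
    ∀ᵐ x ∂(gammaMixture α r l c ν), ∀ j, 0 ≤ x j := by
  have : ∀ j, IsProbabilityMeasure (gammaMeasure α (r j)) :=
    fun j => isProbabilityMeasure_gammaMeasure hα (hr j)
  rw [ae_all_iff]
  intro j
  refine (ae_map_iff measurable_snd.aemeasurable
    (measurableSet_Ici.preimage (measurable_pi_apply j))).2 ?_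
  refine (withDensity_absolutelyContinuous _ _).ae_le ?_
  exact Measure.quasiMeasurePreserving_snd.ae
    ((measurePreserving_eval (fun j => gammaMeasure α (r j)) j).quasiMeasurePreserving.ae
      (ae_nonneg_gammaMeasure α (r j)))

end Mixture

/-! ### The determinant of the two-block matrix. -/

/-- The determinant of `1 + R T` for the two-block correlation matrix. -/
lemma det_one_add_twoBlockCorr {n₁ n₂ : ℕ} {a₁ : Fin n₁ → ℝ} {a₂ : Fin n₂ → ℝ} (ϑ : ℝ)
    {t : Fin n₁ ⊕ Fin n₂ → ℝ}
    (h : ∀ j, 1 + (1 - Sum.elim a₁ a₂ j ^ 2) * t j ≠ 0) :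
    (1 + twoBlockCorr a₁ a₂ ϑ * Matrix.diagonal t).det =
      (∏ j, (1 + (1 - Sum.elim a₁ a₂ j ^ 2) * t j)) *
        ((1 + ∑ i, a₁ i ^ 2 * t (Sum.inl i) / (1 + (1 - a₁ i ^ 2) * t (Sum.inl i))) *
          (1 + ∑ i, a₂ i ^ 2 * t (Sum.inr i) / (1 + (1 - a₂ i ^ 2) * t (Sum.inr i))) -
          ϑ ^ 2 * ((∑ i, a₁ i ^ 2 * t (Sum.inl i) / (1 + (1 - a₁ i ^ 2) * t (Sum.inl i))) *
            ∑ i, a₂ i ^ 2 * t (Sum.inr i) / (1 + (1 - a₂ i ^ 2) * t (Sum.inr i)))) := by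
  -- Off its diagonal part, `R T` has rank at most two. After factoring out the diagonal, `det (1 +
  -- A B) = det (1 + B A)` leaves the matrix with rows `(1 + S₁, ϑ S₁)` and `(ϑ S₂, 1 + S₂)`, where
  -- `S₁, S₂` are the two block sums.
  let A : Matrix (Fin n₁ ⊕ Fin n₂) (Fin 2) ℝ := Matrix.of (Sum.elim
    (fun i k => (1 + (1 - a₁ i ^ 2) * t (Sum.inl i))⁻¹ * a₁ i * ![1, ϑ] k)
    (fun i k => (1 + (1 - a₂ i ^ 2) * t (Sum.inr i))⁻¹ * a₂ i * ![ϑ, 1] k))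
  let B : Matrix (Fin 2) (Fin n₁ ⊕ Fin n₂) ℝ := Matrix.of
    ![Sum.elim (fun i => a₁ i * t (Sum.inl i)) 0, Sum.elim 0 (fun i => a₂ i * t (Sum.inr i))]
  have key : 1 + twoBlockCorr a₁ a₂ ϑ * Matrix.diagonal t =
      Matrix.diagonal (fun j => 1 + (1 - Sum.elim a₁ a₂ j ^ 2) * t j) * (1 + A * B) := by
    ext i j
    have hi := h i
    rw [Matrix.diagonal_mul, Matrix.add_apply, Matrix.add_apply, Matrix.mul_diagonal,
      Matrix.mul_apply, Fin.sum_univ_two]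
    rcases i with i | i <;> rcases j with j | j <;>
      simp only [Sum.elim_inl, Sum.elim_inr] at hi <;>
      simp [A, B, twoBlockCorr, Matrix.vecMulVec_apply, Matrix.one_apply, Matrix.diagonal_apply] <;>
      (try split_ifs with hij) <;> (try subst hij) <;> field_simp <;> ring
  rw [key, Matrix.det_mul, Matrix.det_diagonal, Matrix.det_one_add_mul_comm, Matrix.det_fin_two]
  congr 1
  simp only [Matrix.add_apply, Matrix.mul_apply, Fintype.sum_sum_type]
  simp [A, B]
  have e : ∀ (n : ℕ) (a : Fin n → ℝ) (s : Fin n → ℝ) (w : ℝ),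
      ∑ i, a i * s i * ((1 + (1 - a i ^ 2) * s i)⁻¹ * a i * w) =
        w * ∑ i, a i ^ 2 * s i / (1 + (1 - a i ^ 2) * s i) := by
    intro n a s w
    rw [Finset.mul_sum]
    refine Finset.sum_congr rfl fun i _ => ?_
    ring
  have e1 : ∀ (n : ℕ) (a : Fin n → ℝ) (s : Fin n → ℝ),
      ∑ i, a i * s i * ((1 + (1 - a i ^ 2) * s i)⁻¹ * a i) =
        ∑ i, a i ^ 2 * s i / (1 + (1 - a i ^ 2) * s i) := by
    intro n a s
    simpa using e n a s 1
  rw [e n₁ a₁ (fun i => t (Sum.inl i)), e1 n₁ a₁ (fun i => t (Sum.inl i)),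
    e n₂ a₂ (fun i => t (Sum.inr i)), e1 n₂ a₂ (fun i => t (Sum.inr i))]
  ring

/-! ### The two-block law: transform, uniqueness and cdf. -/

lemma IsKibbleLaw.integrable_of_bound {α ρ : ℝ} {ν : Measure (ℝ × ℝ)} (hν : IsKibbleLaw α ρ ν)
    {f : ℝ × ℝ → ℝ} (hf : Measurable f) (h : ∀ p : ℝ × ℝ, 0 ≤ p.1 → 0 ≤ p.2 → ‖f p‖ ≤ 1) :
    Integrable f ν := by
  have := hν.isProbabilityMeasure
  exact Integrable.of_bound hf.aestronglyMeasurable 1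
    (hν.nonneg.mono fun p hp => h p hp.1 hp.2)

lemma IsKibbleLaw.lintegral_exp {α ρ s t : ℝ} {ν : Measure (ℝ × ℝ)} (hν : IsKibbleLaw α ρ ν)
    (hs : 0 ≤ s) (ht : 0 ≤ t) :
    ∫⁻ p, ENNReal.ofReal (Real.exp (-(s * p.1)) * Real.exp (-(t * p.2))) ∂ν =
      ENNReal.ofReal (((1 + s) * (1 + t) - ρ * (s * t)) ^ (-α)) := by
  rw [← hν.laplace s t hs ht, ofReal_integral_eq_lintegral_ofReal _
    (ae_of_all _ fun p => by positivity)]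
  refine hν.integrable_of_bound (by fun_prop) fun p h1 h2 => ?_
  rw [norm_mul]
  exact mul_le_one₀ (norm_exp_neg_mul_le hs h1) (norm_nonneg _) (norm_exp_neg_mul_le ht h2)

section TwoBlock

variable {n₁ n₂ : ℕ} {a₁ : Fin n₁ → ℝ} {a₂ : Fin n₂ → ℝ}

/-- The two-block multivariate gamma law built from a bivariate mixing distribution `ν`. -/
noncomputable def twoBlockLaw (α : ℝ) (a₁ : Fin n₁ → ℝ) (a₂ : Fin n₂ → ℝ)
    (ν : Measure (ℝ × ℝ)) : Measure (Fin n₁ ⊕ Fin n₂ → ℝ) :=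
  gammaMixture α (fun j => (1 - Sum.elim a₁ a₂ j ^ 2)⁻¹)
    (fun j => (1 - Sum.elim a₁ a₂ j ^ 2)⁻¹ * Sum.elim a₁ a₂ j ^ 2)
    (Sum.elim (fun _ => Prod.fst) (fun _ => Prod.snd)) ν

lemma measurable_sumElim_coord (j : Fin n₁ ⊕ Fin n₂) :
    Measurable ((Sum.elim (fun _ => Prod.fst) (fun _ => Prod.snd) :
      Fin n₁ ⊕ Fin n₂ → ℝ × ℝ → ℝ) j) := by
  rcases j with j | j
  · exact measurable_fst
  · exact measurable_snd

lemma sumElim_coord_nonneg {p : ℝ × ℝ} (h1 : 0 ≤ p.1) (h2 : 0 ≤ p.2) (j : Fin n₁ ⊕ Fin n₂) :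
    0 ≤ (Sum.elim (fun _ => Prod.fst) (fun _ => Prod.snd) :
      Fin n₁ ⊕ Fin n₂ → ℝ × ℝ → ℝ) j p := by
  rcases j with j | j
  · exact h1
  · exact h2

lemma one_sub_sumElim_sq_pos (ha₁ : ∀ j, a₁ j ∈ Ioo (-1 : ℝ) 1) (ha₂ : ∀ j, a₂ j ∈ Ioo (-1 : ℝ) 1)
    (j : Fin n₁ ⊕ Fin n₂) : 0 < 1 - Sum.elim a₁ a₂ j ^ 2 := by
  rcases j with j | j
  · exact one_sub_sq_pos (ha₁ j)
  · exact one_sub_sq_pos (ha₂ j)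

/-- Given `p`, the exponents add up to `-S₁ p.1 - S₂ p.2`, so the `ν`-average is Kibble's transform
at `(S₁, S₂)`. The determinant sees only `ϑ ^ 2`, hence the choice `ρ = ϑ ^ 2`. -/
lemma lintegral_exp_twoBlockLaw {α ϑ : ℝ} (hα : 0 < α) (hϑ : ϑ ^ 2 ≤ 1)
    (ha₁ : ∀ j, a₁ j ∈ Ioo (-1 : ℝ) 1) (ha₂ : ∀ j, a₂ j ∈ Ioo (-1 : ℝ) 1)
    {ν : Measure (ℝ × ℝ)} (hν : IsKibbleLaw α (ϑ ^ 2) ν) {t : Fin n₁ ⊕ Fin n₂ → ℝ}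
    (ht : ∀ j, 0 ≤ t j) :
    ∫⁻ x, ENNReal.ofReal (Real.exp (-∑ j, t j * x j)) ∂(twoBlockLaw α a₁ a₂ ν) =
      ENNReal.ofReal ((1 + twoBlockCorr a₁ a₂ ϑ * Matrix.diagonal t).det ^ (-α)) := by
  have := hν.isProbabilityMeasure
  have hd := one_sub_sumElim_sq_pos ha₁ ha₂
  have hdt : ∀ j, 0 < 1 + (1 - Sum.elim a₁ a₂ j ^ 2) * t j := fun j => by
    have := mul_nonneg (hd j).le (ht j)
    linarith
  have hd₁ : ∀ j, 0 < 1 + (1 - a₁ j ^ 2) * t (Sum.inl j) := fun j => hdt (Sum.inl j)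
  have hd₂ : ∀ j, 0 < 1 + (1 - a₂ j ^ 2) * t (Sum.inr j) := fun j => hdt (Sum.inr j)
  let S₁ := ∑ i, a₁ i ^ 2 * t (Sum.inl i) / (1 + (1 - a₁ i ^ 2) * t (Sum.inl i))
  let S₂ := ∑ i, a₂ i ^ 2 * t (Sum.inr i) / (1 + (1 - a₂ i ^ 2) * t (Sum.inr i))
  have hS₁ : 0 ≤ S₁ := Finset.sum_nonneg fun i _ =>
    div_nonneg (mul_nonneg (sq_nonneg _) (ht _)) (hd₁ i).le
  have hS₂ : 0 ≤ S₂ := Finset.sum_nonneg fun i _ =>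
    div_nonneg (mul_nonneg (sq_nonneg _) (ht _)) (hd₂ i).le
  have hD : 0 < ∏ j, (1 + (1 - Sum.elim a₁ a₂ j ^ 2) * t j) :=
    Finset.prod_pos fun j _ => hdt j
  rw [det_one_add_twoBlockCorr ϑ fun j => (hdt j).ne']
  change _ = ENNReal.ofReal
    ((_ * ((1 + S₁) * (1 + S₂) - ϑ ^ 2 * (S₁ * S₂))) ^ (-α))
  rw [Real.mul_rpow hD.le (by nlinarith [mul_nonneg hS₁ hS₂]),
    ENNReal.ofReal_mul (by positivity), ← hν.lintegral_exp hS₁ hS₂,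
    ← lintegral_const_mul _ (by fun_prop)]
  simp_rw [← Finset.sum_neg_distrib, Real.exp_sum,
    ENNReal.ofReal_prod_of_nonneg fun _ _ => Real.exp_nonneg _]
  rw [twoBlockLaw, lintegral_gammaMixture hα (fun j => inv_pos.mpr (hd j))
    measurable_sumElim_coord (f := fun j x => ENNReal.ofReal (Real.exp (-(t j * x))))
    (fun j => by fun_prop)]
  refine lintegral_congr_ae ?_
  filter_upwards [hν.nonneg] with p hp
  have hterm : ∀ j, ∫⁻ x, ncDensity α ((1 - Sum.elim a₁ a₂ j ^ 2)⁻¹)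
      ((1 - Sum.elim a₁ a₂ j ^ 2)⁻¹ * Sum.elim a₁ a₂ j ^ 2)
      (Sum.elim (fun _ => Prod.fst) (fun _ => Prod.snd) j p) x *
      ENNReal.ofReal (Real.exp (-(t j * x)))
        ∂(gammaMeasure α ((1 - Sum.elim a₁ a₂ j ^ 2)⁻¹)) =
      ENNReal.ofReal ((1 + (1 - Sum.elim a₁ a₂ j ^ 2) * t j) ^ (-α) *
        Real.exp (-(Sum.elim a₁ a₂ j ^ 2 * t j / (1 + (1 - Sum.elim a₁ a₂ j ^ 2) * t j) *
          Sum.elim (fun _ => Prod.fst) (fun _ => Prod.snd) j p))) := by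
    intro j
    have h1 := hd j
    have h2 := hdt j
    have h3 := sumElim_coord_nonneg (n₁ := n₁) (n₂ := n₂) hp.1 hp.2 j
    rw [lintegral_ncDensity_mul_exp hα (inv_pos.mpr h1) (by positivity) (ht j)]
    have e1 : (1 - Sum.elim a₁ a₂ j ^ 2)⁻¹ + t j =
        (1 - Sum.elim a₁ a₂ j ^ 2)⁻¹ * (1 + (1 - Sum.elim a₁ a₂ j ^ 2) * t j) := by
      field_simp
    have e2 : (1 - Sum.elim a₁ a₂ j ^ 2)⁻¹ / ((1 - Sum.elim a₁ a₂ j ^ 2)⁻¹ + t j) =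
        (1 + (1 - Sum.elim a₁ a₂ j ^ 2) * t j)⁻¹ := by
      rw [e1]; field_simp
    rw [e2, e1, Real.inv_rpow h2.le, ← Real.rpow_neg h2.le, mul_assoc (_⁻¹), mul_div_mul_left _ _
      (inv_pos.mpr h1).ne']
  rw [Finset.prod_congr rfl fun j _ => hterm j,
    ← ENNReal.ofReal_prod_of_nonneg fun j _ => mul_nonneg (Real.rpow_nonneg (hdt j).le _)
      (Real.exp_nonneg _),
    ← ENNReal.ofReal_mul (by positivity), Finset.prod_mul_distrib,
    Real.finsetProd_rpow _ _ fun j _ => (hdt j).le, ← Real.exp_sum, Finset.sum_neg_distrib,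
    Fintype.sum_sum_type, ← Real.exp_add]
  simp only [Sum.elim_inl, Sum.elim_inr, ← Finset.sum_mul]
  rw [neg_add]

lemma isGammaLaw_twoBlockLaw {α ϑ : ℝ} (hα : 0 < α) (hϑ : ϑ ^ 2 ≤ 1)
    (ha₁ : ∀ j, a₁ j ∈ Ioo (-1 : ℝ) 1) (ha₂ : ∀ j, a₂ j ∈ Ioo (-1 : ℝ) 1)
    {ν : Measure (ℝ × ℝ)} (hν : IsKibbleLaw α (ϑ ^ 2) ν) :
    IsGammaLaw α (twoBlockCorr a₁ a₂ ϑ) (twoBlockLaw α a₁ a₂ ν) where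
  isProbabilityMeasure := ⟨by
    -- Total mass is the transform at `t = 0`.
    have h := lintegral_exp_twoBlockLaw hα hϑ ha₁ ha₂ hν (t := 0) fun _ => le_rfl
    simpa using h⟩
  nonneg := by
    have := hν.isProbabilityMeasure
    exact ae_nonneg_gammaMixture hα
      (fun j => inv_pos.mpr (one_sub_sumElim_sq_pos ha₁ ha₂ j)) _ _ ν
  laplace t ht := by
    have hdt : ∀ j, 0 < 1 + (1 - Sum.elim a₁ a₂ j ^ 2) * t j := fun j => by
      have := mul_nonneg (one_sub_sumElim_sq_pos ha₁ ha₂ j).le (ht j)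
      linarith
    have hdet : 0 ≤ (1 + twoBlockCorr a₁ a₂ ϑ * Matrix.diagonal t).det := by
      rw [det_one_add_twoBlockCorr ϑ fun j => (hdt j).ne']
      have hS₁ : 0 ≤ ∑ i, a₁ i ^ 2 * t (Sum.inl i) / (1 + (1 - a₁ i ^ 2) * t (Sum.inl i)) :=
        Finset.sum_nonneg fun i _ =>
          div_nonneg (mul_nonneg (sq_nonneg _) (ht _)) (hdt (Sum.inl i)).le
      have hS₂ : 0 ≤ ∑ i, a₂ i ^ 2 * t (Sum.inr i) / (1 + (1 - a₂ i ^ 2) * t (Sum.inr i)) :=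
        Finset.sum_nonneg fun i _ =>
          div_nonneg (mul_nonneg (sq_nonneg _) (ht _)) (hdt (Sum.inr i)).le
      refine mul_nonneg (Finset.prod_nonneg fun j _ => (hdt j).le) ?_
      nlinarith [mul_nonneg hS₁ hS₂]
    have hm : Measurable fun x : Fin n₁ ⊕ Fin n₂ → ℝ => Real.exp (-∑ j, t j * x j) := by fun_prop
    rw [integral_eq_lintegral_of_nonneg_ae (ae_of_all _ fun x => Real.exp_nonneg _)
      hm.aestronglyMeasurable, lintegral_exp_twoBlockLaw hα hϑ ha₁ ha₂ hν ht, ENNReal.toReal_ofReal (by positivity)]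

lemma IsGammaLaw.unique {ι : Type*} [Fintype ι] [DecidableEq ι] {α : ℝ} {R : Matrix ι ι ℝ}
    {μ μ' : Measure (ι → ℝ)} (h : IsGammaLaw α R μ) (h' : IsGammaLaw α R μ') : μ = μ' := by
  have := h.isProbabilityMeasure
  have := h'.isProbabilityMeasure
  exact ext_of_laplace h.nonneg h'.nonneg fun t ht => by rw [h.laplace t ht, h'.laplace t ht]

lemma prod_indicator_Iic {ι : Type*} [Fintype ι] (x z : ι → ℝ) :
    ∏ j, (Iic (x j)).indicator (1 : ℝ → ENNReal) (z j) =
      {z : ι → ℝ | ∀ j, z j ≤ x j}.indicator 1 z := by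
  by_cases h : ∀ j, z j ≤ x j
  · rw [indicator_of_mem (show z ∈ {z : ι → ℝ | ∀ j, z j ≤ x j} from h)]
    exact Finset.prod_eq_one fun j _ => by
      rw [indicator_of_mem (show z j ∈ Iic (x j) from h j)]
      rfl
  · rw [indicator_of_notMem (show z ∉ {z : ι → ℝ | ∀ j, z j ≤ x j} from h)]
    push Not at h
    obtain ⟨j, hj⟩ := h
    exact Finset.prod_eq_zero (Finset.mem_univ j)
      (indicator_of_notMem (by simpa using hj) _)

/-- Given `p`, the orthant probability is a product of non-central cdfs, and the two blocks depend
on `p.1` and `p.2` separately. -/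
lemma jointCdf_twoBlockLaw {α ρ : ℝ} (hα : 0 < α)
    (ha₁ : ∀ j, a₁ j ∈ Ioo (-1 : ℝ) 1) (ha₂ : ∀ j, a₂ j ∈ Ioo (-1 : ℝ) 1)
    {ν : Measure (ℝ × ℝ)} (hν : IsKibbleLaw α ρ ν) (x₁ : Fin n₁ → ℝ) (x₂ : Fin n₂ → ℝ) :
    jointCdf (twoBlockLaw α a₁ a₂ ν) (Sum.elim x₁ x₂) =
      ∫ p, blockProd α a₁ x₁ p.1 * blockProd α a₂ x₂ p.2 ∂ν := by
  have := hν.isProbabilityMeasure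
  have hd := one_sub_sumElim_sq_pos ha₁ ha₂
  have hmeas : MeasurableSet {z : Fin n₁ ⊕ Fin n₂ → ℝ | ∀ j, z j ≤ Sum.elim x₁ x₂ j} := by
    rw [ofPred_forall]
    exact MeasurableSet.iInter fun j => measurableSet_Iic.preimage (measurable_pi_apply j)
  rw [integral_eq_lintegral_of_nonneg_ae]
  · rw [jointCdf, measureReal_def, ← lintegral_indicator_one hmeas]
    simp_rw [← prod_indicator_Iic]
    rw [twoBlockLaw, lintegral_gammaMixture hα (fun j => inv_pos.mpr (hd j))
      measurable_sumElim_coord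
      (f := fun j => (Iic (Sum.elim x₁ x₂ j)).indicator (1 : ℝ → ENNReal))
      (fun j => measurable_one.indicator measurableSet_Iic)]
    congr 1
    refine lintegral_congr_ae ?_
    filter_upwards [hν.nonneg] with p hp
    have hl : ∀ j, 0 ≤ (1 - Sum.elim a₁ a₂ j ^ 2)⁻¹ * Sum.elim a₁ a₂ j ^ 2 *
        Sum.elim (fun _ => Prod.fst) (fun _ => Prod.snd) j p := fun j => by
      have h1 := hd j
      have h3 := sumElim_coord_nonneg (n₁ := n₁) (n₂ := n₂) hp.1 hp.2 j
      positivity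
    rw [Finset.prod_congr rfl fun j _ =>
      lintegral_ncDensity_mul_indicator_Iic hα (inv_pos.mpr (hd j)) (hl j) (Sum.elim x₁ x₂ j),
      ← ENNReal.ofReal_prod_of_nonneg fun j _ => ncCdf_nonneg _ _ (hl j), Fintype.prod_sum_type]
    rfl
  · filter_upwards [hν.nonneg] with p hp
    exact mul_nonneg (blockProd_nonneg α ha₁ x₁ hp.1) (blockProd_nonneg α ha₂ x₂ hp.2)
  · exact (((measurable_blockProd α a₁ x₁).comp measurable_fst).mul
      ((measurable_blockProd α a₂ x₂).comp measurable_snd)).aestronglyMeasurable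

lemma memLp_blockProd {m : ℕ} {α : ℝ} (hα : 0 < α) {a : Fin m → ℝ}
    (ha : ∀ j, a j ∈ Ioo (-1 : ℝ) 1) (x : Fin m → ℝ) :
    MemLp (blockProd α a x) 2 (gammaMeasure α 1) := by
  have := isProbabilityMeasure_gammaMeasure hα one_pos
  exact MemLp.of_bound (measurable_blockProd α a x).aestronglyMeasurable 1
    ((ae_nonneg_gammaMeasure α 1).mono fun y hy => norm_blockProd_le_one α ha x hy)

lemma integrableOn_blockProd_mul_laguerre {m : ℕ} {α : ℝ} (hα : 0 < α) {a : Fin m → ℝ}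
    (ha : ∀ j, a j ∈ Ioo (-1 : ℝ) 1) (x : Fin m → ℝ) (k : ℕ) :
    IntegrableOn (fun y => blockProd α a x y * laguerre (α - 1) k y * gPdf α y) (Ioi 0) :=
  (integrable_gammaMeasure_one_iff hα _).mp
    ((memLp_blockProd hα ha x).integrable_mul (memLp_laguerre hα k))

end TwoBlock

end MultivariateGamma

/-! ### Assembly of both formulas. -/

theorem theorem3 (n₁ n₂ : ℕ) (hn₁ : 1 < n₁) (hn₂ : 1 < n₂)
    (a₁ : Fin n₁ → ℝ) (a₂ : Fin n₂ → ℝ)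
    (ha₁ : ∀ j, a₁ j ∈ Ioo (-1 : ℝ) 1) (ha₂ : ∀ j, a₂ j ∈ Ioo (-1 : ℝ) 1)
    (α ϑ : ℝ) (hα : 0 < α) (hϑ : |ϑ| ≤ 1) :
    (∃! μ : Measure (Fin n₁ ⊕ Fin n₂ → ℝ),
      MultivariateGamma.IsGammaLaw α (MultivariateGamma.twoBlockCorr a₁ a₂ ϑ) μ) ∧
    ∀ μ : Measure (Fin n₁ ⊕ Fin n₂ → ℝ),
      MultivariateGamma.IsGammaLaw α (MultivariateGamma.twoBlockCorr a₁ a₂ ϑ) μ →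
      ∀ (x₁ : Fin n₁ → ℝ) (x₂ : Fin n₂ → ℝ),
        ((∀ k : ℕ, IntegrableOn (fun y => MultivariateGamma.blockProd α a₁ x₁ y *
            MultivariateGamma.laguerre (α - 1) k y * MultivariateGamma.gPdf α y) (Ioi 0)) ∧
          (∀ k : ℕ, IntegrableOn (fun y => MultivariateGamma.blockProd α a₂ x₂ y *
            MultivariateGamma.laguerre (α - 1) k y * MultivariateGamma.gPdf α y) (Ioi 0)) ∧
          HasSum (fun k : ℕ => (Ring.choose (α + (k : ℝ) - 1) k)⁻¹ * ϑ ^ (2 * k) *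
              (∫ y in Ioi (0 : ℝ), MultivariateGamma.blockProd α a₁ x₁ y *
                MultivariateGamma.laguerre (α - 1) k y * MultivariateGamma.gPdf α y) *
              (∫ y in Ioi (0 : ℝ), MultivariateGamma.blockProd α a₂ x₂ y *
                MultivariateGamma.laguerre (α - 1) k y * MultivariateGamma.gPdf α y))
            (MultivariateGamma.jointCdf μ (Sum.elim x₁ x₂))) ∧
        (|ϑ| < 1 →
          IntegrableOn (fun y : ℝ × ℝ =>
            MultivariateGamma.blockProd α a₁ x₁ ((1 - ϑ ^ 2) * y.1) *
              MultivariateGamma.blockProd α a₂ x₂ ((1 - ϑ ^ 2) * y.2) *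
              MultivariateGamma.hyp0F1 α (ϑ ^ 2 * y.1 * y.2) *
              MultivariateGamma.gPdf α y.1 * MultivariateGamma.gPdf α y.2)
            (Ioi 0 ×ˢ Ioi 0) ∧
          MultivariateGamma.jointCdf μ (Sum.elim x₁ x₂) =
            (1 - ϑ ^ 2) ^ α * ∫ y in Ioi (0 : ℝ) ×ˢ Ioi (0 : ℝ),
              MultivariateGamma.blockProd α a₁ x₁ ((1 - ϑ ^ 2) * y.1) *
              MultivariateGamma.blockProd α a₂ x₂ ((1 - ϑ ^ 2) * y.2) *
              MultivariateGamma.hyp0F1 α (ϑ ^ 2 * y.1 * y.2) *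
              MultivariateGamma.gPdf α y.1 * MultivariateGamma.gPdf α y.2) := by
  have hϑ2 : ϑ ^ 2 ≤ 1 := by rwa [sq_le_one_iff_abs_le_one]
  have hϑabs : |ϑ ^ 2| ≤ 1 := by rwa [abs_of_nonneg (sq_nonneg ϑ)]
  obtain ⟨ν, hν⟩ := MultivariateGamma.exists_isKibbleLaw hα (sq_nonneg ϑ) hϑ2
  have law := MultivariateGamma.isGammaLaw_twoBlockLaw hα hϑ2 ha₁ ha₂ hν
  refine ⟨⟨_, law, fun μ hμ => hμ.unique law⟩, fun μ hμ x₁ x₂ => ⟨⟨?_, ?_, ?_⟩, ?_⟩⟩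
  · exact MultivariateGamma.integrableOn_blockProd_mul_laguerre hα ha₁ x₁
  · exact MultivariateGamma.integrableOn_blockProd_mul_laguerre hα ha₂ x₂
  -- Any Kibble law serves here, including the diagonal one for `|ϑ| = 1`. `HasSum` over `ℝ` is
  -- unconditional, hence absolute, convergence.
  · rw [hμ.unique law, MultivariateGamma.jointCdf_twoBlockLaw hα ha₁ ha₂ hν]
    have h := hν.hasSum_laguerre hα hϑabs (MultivariateGamma.memLp_blockProd hα ha₁ x₁)
      (MultivariateGamma.memLp_blockProd hα ha₂ x₂)
    simpa only [MultivariateGamma.integral_gammaMeasure_one hα, pow_mul] using h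
  · intro hlt
    have hρ1 : ϑ ^ 2 < 1 := by rwa [sq_lt_one_iff_abs_lt_one]
    have hr : 0 < (1 - ϑ ^ 2) ^ α := Real.rpow_pos_of_pos (by linarith) _
    -- By uniqueness the same `μ` may now be represented through the explicit `kibbleMeasure`.
    have hκ := MultivariateGamma.isKibbleLaw_kibbleMeasure hα (sq_nonneg ϑ) hρ1
    have hint : Integrable (fun p : ℝ × ℝ => MultivariateGamma.blockProd α a₁ x₁ p.1 *
        MultivariateGamma.blockProd α a₂ x₂ p.2) (MultivariateGamma.kibbleMeasure α (ϑ ^ 2)) := by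
      refine hκ.integrable_of_bound
        (((MultivariateGamma.measurable_blockProd α a₁ x₁).comp measurable_fst).mul
          ((MultivariateGamma.measurable_blockProd α a₂ x₂).comp measurable_snd)) fun p h1 h2 => ?_
      rw [norm_mul]
      exact mul_le_one₀ (MultivariateGamma.norm_blockProd_le_one α ha₁ x₁ h1) (norm_nonneg _)
        (MultivariateGamma.norm_blockProd_le_one α ha₂ x₂ h2)
    have hfun : (fun p : ℝ × ℝ => MultivariateGamma.kibbleDensity α (ϑ ^ 2) p *
          (MultivariateGamma.blockProd α a₁ x₁ ((1 - ϑ ^ 2) * p.1) *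
            MultivariateGamma.blockProd α a₂ x₂ ((1 - ϑ ^ 2) * p.2))) =
        fun p => (1 - ϑ ^ 2) ^ α * (MultivariateGamma.blockProd α a₁ x₁ ((1 - ϑ ^ 2) * p.1) *
            MultivariateGamma.blockProd α a₂ x₂ ((1 - ϑ ^ 2) * p.2) *
            MultivariateGamma.hyp0F1 α (ϑ ^ 2 * p.1 * p.2)) := by
      funext p
      rw [MultivariateGamma.kibbleDensity]
      ring
    constructor
    · have h := MultivariateGamma.integrable_kibbleMeasure hα (sq_nonneg ϑ) hρ1 hint
      rw [hfun, integrable_const_mul_iff (IsUnit.mk0 _ hr.ne'),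
        MultivariateGamma.integrable_prod_gammaMeasure_iff hα] at h
      exact h
    · rw [hμ.unique (MultivariateGamma.isGammaLaw_twoBlockLaw hα hϑ2 ha₁ ha₂ hκ),
        MultivariateGamma.jointCdf_twoBlockLaw hα ha₁ ha₂ hκ,
        MultivariateGamma.integral_kibbleMeasure hα (sq_nonneg ϑ) hρ1 hint.aestronglyMeasurable,
        hfun, integral_const_mul, MultivariateGamma.integral_prod_gammaMeasure hα]
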